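/- For a local ring $(R,\mathfrak m)$ of prime characteristic $p$ and Krull dimension $d$, and a real number $s>0$, let $$h_s(R)=\lim_{e\to\infty}\frac{\lambda\bigl(R/(\mathfrak m^{\lceil sp^e\rceil}+\mathfrak m^{[p^e]})\bigr)}{p^{ed}},\qquad \mathcal H_s(d)=\sum_{i=0}^{\lfloor s\rfloor}\frac{(-1)^i}{d!}\binom di (s-i)^d,\qquad e_s(R)=\frac{h_s(R)}{\mathcal H_s(d)},$$ where $\lambda$ denotes length and $\mathfrak m^{[p^e]}$ is the ideal generated by the $p^e$-th powers of the elements of $\mathfrak m$. The number $e_s(R)$ is the $s$-multiplicity of $R$. **Theorem.** Let $k$ be an uncountable algebraically closed field of characteristic $p>2$, let $n\ge 0$ and $S=k[[x_0,\dots,x_n]]$, and let $f,g\in(x_0,\dots,x_n)$ with $f\neq 0$ and $g\notin (f)$. Then there is a subset $\Lambda\subseteq k$, dense in the finite complement topology on $k$, such that for every $\alpha\in\Lambda$ and every real $s>0$ the limits defining $e_s(S/(f))$ and $e_s(S/(f+\alpha g))$ exist and $$e_s\bigl(S/(f+\alpha g)\bigr)\le e_s\bigl(S/(f)\bigr).$$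 -/

import Mathlib

open Filter Topology

noncomputable section

/-- The Frobenius power `J^[q]`: the ideal generated by the `q`-th powers of the elements
of `J` (used for `q = p ^ e` in rings of characteristic `p`). -/
def frobeniusPower {R : Type*} [CommRing R] (J : Ideal R) (q : ℕ) : Ideal R :=
  Ideal.span ((fun x : R => x ^ q) '' (J : Set R))

/-- The Krull dimension as a natural number (for local rings of finite dimension). -/
def dimNat (R : Type*) [CommRing R] : ℕ :=
  ((ringKrullDim R).unbotD 0).toNat

/-- The normalized colength `λ(R / (I^⌈s p^e⌉ + J^[p^e])) / p^(e d)`, where `d = dim R`. -/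
def normalizedColength {R : Type*} [CommRing R] (p : ℕ) (s : ℝ) (I J : Ideal R) (e : ℕ) : ℝ :=
  ((Module.length R (R ⧸ (I ^ ⌈s * (p : ℝ) ^ e⌉₊ ⊔ frobeniusPower J (p ^ e)))).toNat : ℝ) /
    (p : ℝ) ^ (e * dimNat R)

/-- `h_s(I, J) = lim_{e → ∞} λ(R / (I^⌈s p^e⌉ + J^[p^e])) / p^(e d)`. -/
def hLimit {R : Type*} [CommRing R] (p : ℕ) (s : ℝ) (I J : Ideal R) : ℝ :=
  limUnder atTop (normalizedColength p s I J)

/-- The normalizing factor `H_s(d) = ∑_{i=0}^{⌊s⌋} (-1)^i / d! * (d choose i) * (s - i)^d`. -/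
def normalizingFactor (s : ℝ) (d : ℕ) : ℝ :=
  ∑ i ∈ Finset.range (⌊s⌋₊ + 1),
    (-1 : ℝ) ^ i / (d.factorial : ℝ) * (d.choose i : ℝ) * (s - (i : ℝ)) ^ d

/-- The `s`-multiplicity `e_s(I, J) = h_s(I, J) / H_s(dim R)`. -/
def sMultiplicityPair {R : Type*} [CommRing R] (p : ℕ) (s : ℝ) (I J : Ideal R) : ℝ :=
  hLimit p s I J / normalizingFactor s (dimNat R)

/-- `e_s(R) = e_s(𝔪, 𝔪)` for a local ring `(R, 𝔪)` of characteristic `p`. -/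
def sMultiplicity (R : Type*) [CommRing R] [IsLocalRing R] (p : ℕ) (s : ℝ) : ℝ :=
  sMultiplicityPair p s (IsLocalRing.maximalIdeal R) (IsLocalRing.maximalIdeal R)

/-- The limit defining `e_s(R)` exists. -/
def SMultiplicityExists (R : Type*) [CommRing R] [IsLocalRing R] (p : ℕ) (s : ℝ) : Prop :=
  ∃ h : ℝ, Tendsto
    (normalizedColength p s (IsLocalRing.maximalIdeal R) (IsLocalRing.maximalIdeal R))
    atTop (𝓝 h)

/-- The quotient of a local ring by an element of its maximal ideal is local. -/
theorem isLocalRing_quotient_span {S : Type*} [CommRing S] [IsLocalRing S] {f : S}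
    (hf : f ∈ IsLocalRing.maximalIdeal S) : IsLocalRing (S ⧸ Ideal.span {f}) := by
  have : Nontrivial (S ⧸ Ideal.span {f}) := by
    rw [Ideal.Quotient.nontrivial_iff]
    intro h
    rw [Ideal.span_singleton_eq_top] at h
    exact (IsLocalRing.mem_maximalIdeal f).1 hf h
  exact IsLocalRing.of_surjective' (Ideal.Quotient.mk _) Ideal.Quotient.mk_surjective

/-- `f + α g` lies in the maximal ideal if `f` and `g` do. -/
theorem add_smul_mem_maximalIdeal {k S : Type*} [Field k] [CommRing S] [Algebra k S]
    [IsLocalRing S] {f g : S} (hf : f ∈ IsLocalRing.maximalIdeal S)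
    (hg : g ∈ IsLocalRing.maximalIdeal S) (α : k) :
    f + α • g ∈ IsLocalRing.maximalIdeal S :=
  Ideal.add_mem _ hf (Submodule.smul_of_tower_mem _ α hg)

end

/-! Work in S, with 𝔪 its maximal ideal. For fixed a and q, the colength of (f) + 𝔪^a + 𝔪^[q] is the
dimension of the kernel of multiplication by f on the finite-dimensional space S/(𝔪^a + 𝔪^[q]). In
the pencil f + αg this kernel exceeds its size at α = 0 for only finitely many α
(`finite_setOf_finrank_quotient_lt`). There are countably many pairs (a, q), and k is uncountable,
so infinitely many α avoid every exceptional set. These α form Λ: infinite sets are dense in the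
cofinite topology. For α in Λ the colengths compare for all (a, q), hence for all s and e, and the
inequality passes to the limit. Both hypersurfaces have dimension n, and the common normalizing
factor is nonnegative.

The limits exist because the normalized colengths are bounded and increase up to a geometric error.
Frobenius over a perfect field gives p^n λ(S/((f) + J)) ≤ λ(S/((f) + J^[p]))
(`pow_mul_finrank_le_finrank_span_sup_frobeniusPower`). For J = 𝔪^a + 𝔪^[q] the ideal J^[p] contains
the mixed power of the next level, except that the exponent of 𝔪 must be raised by a constant. That
raise changes the colength by no more than the Hilbert–Samuel function of S/(f) grows over boundedly
many steps, which is O(p^{e(n-1)}) (`mul_finrank_hypersurface_add_le`). -/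

noncomputable section

/-! ### Colengths of ideals as dimensions over k. -/

section Colength

variable {k A : Type*} [Field k] [CommRing A] [Algebra k A]

/-- A quotient of a finite-dimensional quotient is finite-dimensional. -/
theorem moduleFinite_quotient_of_le {I J : Ideal A} (h : I ≤ J) [Module.Finite k (A ⧸ I)] :
    Module.Finite k (A ⧸ J) :=
  Module.Finite.of_surjective (Ideal.Quotient.factorₐ k h).toLinearMap
    (Ideal.Quotient.factor_surjective h)

theorem finrank_quotient_le_of_le {I J : Ideal A} (h : I ≤ J) [Module.Finite k (A ⧸ I)] :
    Module.finrank k (A ⧸ J) ≤ Module.finrank k (A ⧸ I) :=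
  LinearMap.finrank_le_finrank_of_surjective (f := (Ideal.Quotient.factorₐ k h).toLinearMap)
    (Ideal.Quotient.factor_surjective h)

/-- The colengths of `J`, `(f) + J` and `J : f` are related by the exact sequence of
multiplication by `f` on `A ⧸ J`. -/
theorem finrank_quotient_eq_add_of_colon (f : A) (J C : Ideal A)
    (hC : ∀ x, x ∈ C ↔ f * x ∈ J) [Module.Finite k (A ⧸ J)] :
    Module.finrank k (A ⧸ J) =
      Module.finrank k (A ⧸ (Ideal.span {f} ⊔ J)) + Module.finrank k (A ⧸ C) := by
  have h1 : J ≤ Ideal.span {f} ⊔ J := le_sup_right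
  set π := (Ideal.Quotient.factorₐ k h1).toLinearMap with hπ
  set μ : A →ₗ[k] A ⧸ J := (Ideal.Quotient.mkₐ k J).toLinearMap ∘ₗ LinearMap.mulLeft k f with hμ
  have hker : LinearMap.ker π = LinearMap.range μ := by
    ext y
    obtain ⟨a, rfl⟩ := Ideal.Quotient.mk_surjective y
    have e1 : Ideal.Quotient.mk J a ∈ LinearMap.ker π ↔ a ∈ Ideal.span {f} ⊔ J := by
      rw [LinearMap.mem_ker]
      simp only [hπ, AlgHom.toLinearMap_apply, Ideal.Quotient.factorₐ_apply_mk]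
      exact Ideal.Quotient.eq_zero_iff_mem
    rw [e1, Submodule.mem_sup]
    constructor
    · rintro ⟨b, hb, c, hc, rfl⟩
      obtain ⟨t, rfl⟩ := Ideal.mem_span_singleton'.1 hb
      refine ⟨t, ?_⟩
      simp only [hμ, LinearMap.comp_apply, LinearMap.mulLeft_apply, AlgHom.toLinearMap_apply,
        Ideal.Quotient.mkₐ_eq_mk]
      rw [Ideal.Quotient.eq]
      have : f * t - (t * f + c) = -c := by ring
      rw [this]
      exact J.neg_mem hc
    · rintro ⟨t, ht⟩
      simp only [hμ, LinearMap.comp_apply, LinearMap.mulLeft_apply, AlgHom.toLinearMap_apply,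
        Ideal.Quotient.mkₐ_eq_mk] at ht
      rw [Ideal.Quotient.eq] at ht
      exact ⟨f * t, Ideal.mem_span_singleton.2 (Dvd.intro _ rfl), -(f * t - a),
        J.neg_mem ht, by ring⟩
  have hμker : LinearMap.ker μ = C.restrictScalars k := by
    ext x
    rw [LinearMap.mem_ker, Submodule.restrictScalars_mem, hC]
    exact Ideal.Quotient.eq_zero_iff_mem
  have e2 : Module.finrank k (LinearMap.range μ) = Module.finrank k (A ⧸ C) := by
    rw [← μ.quotKerEquivRange.finrank_eq, hμker]
    exact (Submodule.Quotient.restrictScalarsEquiv k C).finrank_eq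
  have e3 := π.finrank_range_add_finrank_ker
  rw [hker, e2, LinearMap.range_eq_top.2 (Ideal.Quotient.factor_surjective h1), finrank_top] at e3
  exact e3.symm

/-- Multiplication by f splits the left side: adding f gives at least (f) + J, and the colon ideal
by f contains (g) + J. -/
theorem finrank_quotient_span_mul_le (f g : A) (J : Ideal A) [Module.Finite k (A ⧸ J)] :
    Module.finrank k (A ⧸ (Ideal.span {f * g} ⊔ J)) ≤
      Module.finrank k (A ⧸ (Ideal.span {f} ⊔ J)) +
        Module.finrank k (A ⧸ (Ideal.span {g} ⊔ J)) := by
  have : Module.Finite k (A ⧸ (Ideal.span {f * g} ⊔ J)) :=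
    moduleFinite_quotient_of_le (I := J) le_sup_right
  have : Module.Finite k (A ⧸ (Ideal.span {g} ⊔ J)) :=
    moduleFinite_quotient_of_le (I := J) le_sup_right
  have : Module.Finite k (A ⧸ (Ideal.span {f} ⊔ J)) :=
    moduleFinite_quotient_of_le (I := J) le_sup_right
  rw [finrank_quotient_eq_add_of_colon (k := k) f (Ideal.span {f * g} ⊔ J)
    (Submodule.comap (LinearMap.mulLeft A f) (Ideal.span {f * g} ⊔ J)) (fun x => Iff.rfl)]
  refine add_le_add (finrank_quotient_le_of_le (sup_le_sup_left le_sup_right _))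
    (finrank_quotient_le_of_le (sup_le ?_ ?_))
  · rw [Ideal.span_singleton_le_iff_mem]
    exact Ideal.mem_sup_left (Ideal.mem_span_singleton_self _ : f * g ∈ _)
  · intro x hx
    exact Ideal.mem_sup_right (J.mul_mem_left f hx)

theorem finrank_quotient_span_pow_le (f : A) (J : Ideal A) [Module.Finite k (A ⧸ J)] (r : ℕ) :
    Module.finrank k (A ⧸ (Ideal.span {f ^ r} ⊔ J)) ≤
      r * Module.finrank k (A ⧸ (Ideal.span {f} ⊔ J)) := by
  induction r with
  | zero =>
    have : (Ideal.span {f ^ 0} ⊔ J) = ⊤ := by simp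
    rw [this]
    simp [Module.finrank_eq_zero_of_subsingleton]
  | succ r ih =>
    rw [pow_succ, add_mul, one_mul]
    exact (finrank_quotient_span_mul_le _ _ J).trans (by gcongr)

/-- Enlarging `I ≤ J` by `K` does not increase the colength difference. -/
theorem finrank_quotient_sup_add_le {I J : Ideal A} (K : Ideal A) (h : I ≤ J)
    [Module.Finite k (A ⧸ I)] :
    Module.finrank k (A ⧸ (I ⊔ K)) + Module.finrank k (A ⧸ J) ≤
      Module.finrank k (A ⧸ I) + Module.finrank k (A ⧸ (J ⊔ K)) := by
  have hIK : I ≤ I ⊔ K := le_sup_left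
  have hJK : I ≤ J ⊔ K := h.trans le_sup_left
  have key : ∀ {L : Ideal A} (hL : I ≤ L), Module.finrank k (A ⧸ L) +
      Module.finrank k (LinearMap.ker (Ideal.Quotient.factorₐ k hL).toLinearMap) =
      Module.finrank k (A ⧸ I) := by
    intro L hL
    rw [← (Ideal.Quotient.factorₐ k hL).toLinearMap.finrank_range_add_finrank_ker,
      LinearMap.range_eq_top.2 (Ideal.Quotient.factor_surjective hL), finrank_top]
  have hmem : ∀ {L : Ideal A} (hL : I ≤ L) (a : A), Ideal.Quotient.mk I a ∈
      LinearMap.ker (Ideal.Quotient.factorₐ k hL).toLinearMap ↔ a ∈ L := by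
    intro L hL a
    rw [LinearMap.mem_ker]
    exact Ideal.Quotient.eq_zero_iff_mem
  -- Inside A/I, the image of J + K is the sum of those of J and I + K, so its dimension is at most
  -- the sum of theirs.
  have hsup : LinearMap.ker (Ideal.Quotient.factorₐ k hJK).toLinearMap ≤
      LinearMap.ker (Ideal.Quotient.factorₐ k h).toLinearMap ⊔
        LinearMap.ker (Ideal.Quotient.factorₐ k hIK).toLinearMap := by
    intro y hy
    obtain ⟨a, rfl⟩ := Ideal.Quotient.mk_surjective y
    rw [hmem, Submodule.mem_sup] at hy
    obtain ⟨b, hb, c, hc, rfl⟩ := hy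
    rw [map_add]
    exact Submodule.add_mem_sup ((hmem h b).2 hb) ((hmem hIK c).2 (Ideal.mem_sup_right hc))
  have h1 := key h
  have h2 := key hIK
  have h3 := key hJK
  have h4 := (Submodule.finrank_mono hsup).trans (Submodule.finrank_add_le_finrank_add_finrank _ _)
  omega

end Colength

/-! ### Powers of the maximal ideal and Hilbert–Samuel functions. -/

section PowerSeriesIdeals

open MvPowerSeries Finsupp

variable {k : Type*} [Field k] {n : ℕ}

theorem MvPowerSeries.mem_maximalIdeal_iff {σ : Type*} {f : MvPowerSeries σ k} :
    f ∈ IsLocalRing.maximalIdeal (MvPowerSeries σ k) ↔ constantCoeff f = 0 := by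
  rw [IsLocalRing.mem_maximalIdeal, mem_nonunits_iff, MvPowerSeries.isUnit_iff_constantCoeff,
    isUnit_iff_ne_zero, not_not]

theorem MvPowerSeries.X_mem_maximalIdeal {σ : Type*} (i : σ) :
    (X i : MvPowerSeries σ k) ∈ IsLocalRing.maximalIdeal (MvPowerSeries σ k) := by
  rw [MvPowerSeries.mem_maximalIdeal_iff, constantCoeff_X]

/-- A power series without constant term is a combination of the variables, with coefficients
of order at least one less. -/
theorem MvPowerSeries.exists_eq_sum_X_mul {m : ℕ} {f : MvPowerSeries (Fin m) k} {a : ℕ}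
    (hf : ∀ d, degree d < a + 1 → coeff d f = 0) :
    ∃ F : Fin m → MvPowerSeries (Fin m) k, f = ∑ i, X i * F i ∧
      ∀ i d, degree d < a → coeff d (F i) = 0 := by
  classical
  -- Each monomial of f is assigned to the first variable dividing it, so no monomial is counted
  -- twice.
  obtain ⟨F, hF⟩ : ∃ F : Fin m → MvPowerSeries (Fin m) k, ∀ i d, coeff d (F i) =
      if ∀ j < i, d j = 0 then coeff (d + single i 1) f else 0 := ⟨fun i d => _, fun i d => rfl⟩
  refine ⟨F, ?_, ?_⟩
  · ext w
    have hc : ∀ i, coeff w (X i * F i) =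
        if w i ≠ 0 ∧ ∀ j < i, w j = 0 then coeff w f else 0 := by
      intro i
      rw [X_def, coeff_monomial_mul, one_mul, hF]
      by_cases hi : w i = 0
      · rw [if_neg, if_neg]
        · simp [hi]
        · rw [Finsupp.single_le_iff]
          omega
      · have hle : single i 1 ≤ w := by
          rw [Finsupp.single_le_iff]
          omega
        rw [if_pos hle]
        rw [tsub_add_cancel_of_le hle]
        refine if_congr ?_ rfl rfl
        constructor
        · intro h
          refine ⟨hi, fun j hj => ?_⟩
          have := h j hj
          rwa [Finsupp.tsub_apply, Finsupp.single_eq_of_ne hj.ne, Nat.sub_zero] at this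
        · intro h j hj
          rw [Finsupp.tsub_apply, Finsupp.single_eq_of_ne hj.ne, Nat.sub_zero, h.2 j hj]
    rw [map_sum]
    simp_rw [hc]
    by_cases hw : w = 0
    · subst hw
      rw [hf 0 (by simp)]
      simp
    · have hex : ∃ i, w i ≠ 0 := by
        by_contra! h
        exact hw (Finsupp.ext h)
      obtain ⟨i, hi, hmin⟩ := WellFounded.has_min (wellFounded_lt (α := Fin m)) {i | w i ≠ 0} hex
      have hmin' : ∀ j < i, w j = 0 := fun j hj => by
        by_contra h
        exact hmin j h hj
      rw [Finset.sum_eq_single i, if_pos ⟨hi, hmin'⟩]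
      · intro j _ hji
        rw [if_neg]
        rintro ⟨h1, h2⟩
        rcases lt_or_gt_of_ne hji with h | h
        · exact h1 (hmin' j h)
        · exact hi (h2 i h)
      · simp
  · intro i d hd
    rw [hF, hf (d + single i 1) (by simpa using hd), ite_self]

theorem MvPowerSeries.mem_maximalIdeal_pow_iff {m : ℕ} {f : MvPowerSeries (Fin m) k} {a : ℕ} :
    f ∈ IsLocalRing.maximalIdeal (MvPowerSeries (Fin m) k) ^ a ↔
      ∀ d, degree d < a → coeff d f = 0 := by
  constructor
  · intro h d hd
    apply coeff_of_lt_order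
    refine lt_of_lt_of_le (Nat.cast_lt.2 hd) ?_
    clear hd
    induction a generalizing f with
    | zero => simp
    | succ a ih =>
      rw [pow_succ] at h
      refine Submodule.mul_induction_on h (fun x hx y hy => ?_) (fun x y hx hy => ?_)
      · refine le_trans ?_ le_order_mul
        push_cast
        exact add_le_add (ih hx)
          (one_le_order_iff_constCoeff_eq_zero.2 (mem_maximalIdeal_iff.1 hy))
      · exact (le_min hx hy).trans min_order_le_add
  · intro h
    induction a generalizing f with
    | zero => simp
    | succ a ih =>
      obtain ⟨F, rfl, hF⟩ := exists_eq_sum_X_mul h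
      refine Ideal.sum_mem _ fun i _ => ?_
      rw [pow_succ']
      exact Ideal.mul_mem_mul (X_mem_maximalIdeal i) (ih (hF i))

theorem MvPowerSeries.mem_maximalIdeal_pow_iff_le_order {m : ℕ} {f : MvPowerSeries (Fin m) k}
    {a : ℕ} : f ∈ IsLocalRing.maximalIdeal (MvPowerSeries (Fin m) k) ^ a ↔ (a : ℕ∞) ≤ f.order := by
  rw [mem_maximalIdeal_pow_iff]
  exact ⟨nat_le_order, fun h d hd =>
    coeff_of_lt_order (lt_of_lt_of_le (Nat.cast_lt.2 hd) h)⟩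

/-- The exponents of degree less than `a`. -/
def exponentsOfDegreeLT (m a : ℕ) : Finset (Fin m →₀ ℕ) :=
  (Finset.range a).biUnion fun j => Finset.finsuppAntidiag Finset.univ j

theorem mem_exponentsOfDegreeLT {m a : ℕ} {d : Fin m →₀ ℕ} :
    d ∈ exponentsOfDegreeLT m a ↔ degree d < a := by
  simp [exponentsOfDegreeLT, Finset.mem_finsuppAntidiag, degree_eq_sum]

theorem card_exponentsOfDegreeLT (n a : ℕ) :
    (exponentsOfDegreeLT (n + 1) a).card = ∑ j ∈ Finset.range a, (n + j).choose n := by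
  rw [exponentsOfDegreeLT, Finset.card_biUnion]
  · refine Finset.sum_congr rfl fun j _ => ?_
    rw [Finset.card_finsuppAntidiag_nat_eq_choose, Finset.card_univ, Fintype.card_fin,
      show n + 1 + j - 1 = n + j by omega, Nat.choose_symm_add]
  · intro i _ j _ hij
    rw [Function.onFun, Finset.disjoint_left]
    intro d h1 h2
    rw [Finset.mem_finsuppAntidiag] at h1 h2
    exact hij (h1.1.symm.trans h2.1)

/-- The coefficients of degree less than `a`, as a linear map. -/
def lowCoeffs (k : Type*) [Field k] (m a : ℕ) :
    MvPowerSeries (Fin m) k →ₗ[k] (exponentsOfDegreeLT m a → k) :=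
  LinearMap.pi fun d => coeff (d : Fin m →₀ ℕ)

theorem lowCoeffs_surjective (m a : ℕ) : Function.Surjective (lowCoeffs k m a) := by
  classical
  intro c
  refine ⟨fun d => if h : d ∈ exponentsOfDegreeLT m a then c ⟨d, h⟩ else 0, ?_⟩
  ext d
  change (if h : (d : Fin m →₀ ℕ) ∈ exponentsOfDegreeLT m a then c ⟨d, h⟩ else 0) = c d
  rw [dif_pos d.2]

theorem ker_lowCoeffs (m a : ℕ) : LinearMap.ker (lowCoeffs k m a) =
    (IsLocalRing.maximalIdeal (MvPowerSeries (Fin m) k) ^ a).restrictScalars k := by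
  ext f
  rw [LinearMap.mem_ker, Submodule.restrictScalars_mem, mem_maximalIdeal_pow_iff, funext_iff]
  exact ⟨fun h d hd => h ⟨d, mem_exponentsOfDegreeLT.2 hd⟩,
    fun h d => h d (mem_exponentsOfDegreeLT.1 d.2)⟩

/-- The power series ring modulo a power of its maximal ideal, as a space of coefficients. -/
def quotientMaximalIdealPowEquiv (k : Type*) [Field k] (m a : ℕ) :
    (MvPowerSeries (Fin m) k ⧸ IsLocalRing.maximalIdeal (MvPowerSeries (Fin m) k) ^ a) ≃ₗ[k]
      (exponentsOfDegreeLT m a → k) :=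
  (Submodule.Quotient.restrictScalarsEquiv k _).symm ≪≫ₗ
    Submodule.quotEquivOfEq _ _ (ker_lowCoeffs m a).symm ≪≫ₗ
    (lowCoeffs k m a).quotKerEquivOfSurjective (lowCoeffs_surjective m a)

instance moduleFinite_quotient_maximalIdeal_pow (m a : ℕ) : Module.Finite k
    (MvPowerSeries (Fin m) k ⧸ IsLocalRing.maximalIdeal (MvPowerSeries (Fin m) k) ^ a) :=
  Module.Finite.equiv (quotientMaximalIdealPowEquiv k m a).symm

theorem finrank_quotient_maximalIdeal_pow (n a : ℕ) : Module.finrank k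
    (MvPowerSeries (Fin (n + 1)) k ⧸
      IsLocalRing.maximalIdeal (MvPowerSeries (Fin (n + 1)) k) ^ a) =
    ∑ j ∈ Finset.range a, (n + j).choose n := by
  rw [(quotientMaximalIdealPowEquiv k (n + 1) a).finrank_eq, Module.finrank_fintype_fun_eq_card,
    Fintype.card_coe, card_exponentsOfDegreeLT]

/-- The Hilbert–Samuel function of a hypersurface of order `r`. -/
theorem finrank_quotient_span_sup_maximalIdeal_pow {f : MvPowerSeries (Fin (n + 1)) k} {r : ℕ}
    (hr : f.order = r) (a : ℕ) :
    Module.finrank k (MvPowerSeries (Fin (n + 1)) k ⧸ (Ideal.span {f} ⊔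
      IsLocalRing.maximalIdeal (MvPowerSeries (Fin (n + 1)) k) ^ (a + r))) =
    ∑ i ∈ Finset.range r, (n + (a + i)).choose n := by
  -- Order is additive on products, so the colon ideal of 𝔪^(a+r) by f is 𝔪^a.
  have h := finrank_quotient_eq_add_of_colon (k := k) f
    (IsLocalRing.maximalIdeal (MvPowerSeries (Fin (n + 1)) k) ^ (a + r))
    (IsLocalRing.maximalIdeal (MvPowerSeries (Fin (n + 1)) k) ^ a) (fun x => by
      rw [mem_maximalIdeal_pow_iff_le_order, mem_maximalIdeal_pow_iff_le_order, order_mul, hr,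
        Nat.cast_add, add_comm (r : ℕ∞)]
      exact (ENat.add_le_add_iff_right (ENat.natCast_ne_top r)).symm)
  rw [finrank_quotient_maximalIdeal_pow, finrank_quotient_maximalIdeal_pow,
    Finset.sum_range_add] at h
  omega

end PowerSeriesIdeals

/-! ### Length as dimension over k. -/

section Length

variable {k A : Type*} [Field k] [CommRing A] [Algebra k A] [IsLocalRing A]

theorem finrank_quotient_maximalIdeal_eq_one
    (hres : ∀ a : A, ∃ c : k, a - algebraMap k A c ∈ IsLocalRing.maximalIdeal A) :
    Module.finrank k (A ⧸ IsLocalRing.maximalIdeal A) = 1 := by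
  refine finrank_eq_one_iff_of_nonzero' (1 : A ⧸ IsLocalRing.maximalIdeal A) one_ne_zero |>.2 ?_
  intro w
  obtain ⟨a, rfl⟩ := Ideal.Quotient.mk_surjective w
  obtain ⟨c, hc⟩ := hres a
  refine ⟨c, ?_⟩
  rw [← Ideal.Quotient.eq] at hc
  rw [hc, Algebra.smul_def, mul_one]
  rfl

/-- Over a local algebra whose residue field is the base field, length is dimension. -/
theorem length_eq_finrank_of_residue
    (hres : ∀ a : A, ∃ c : k, a - algebraMap k A c ∈ IsLocalRing.maximalIdeal A)
    (M : Type*) [AddCommGroup M] [Module A M] [Module k M] [IsScalarTower k A M]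
    [Module.Finite k M] : Module.length A M = Module.finrank k M := by
  obtain ⟨d, hd⟩ : ∃ d, Module.finrank k M = d := ⟨_, rfl⟩
  induction d generalizing M with
  | zero =>
    have : Subsingleton M := Module.finrank_zero_iff.1 hd
    rw [hd, Module.length_eq_zero]
    rfl
  | succ d ih =>
    have : Nontrivial M := Module.nontrivial_of_finrank_pos (R := k) (by omega)
    have : Module.Finite A M := Module.Finite.of_restrictScalars_finite k A M
    -- A maximal submodule has quotient the residue field, of length and k-dimension one; induct on
    -- N.
    obtain ⟨N, hN⟩ := IsCoatomic.exists_coatom (Submodule A M)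
    have hsimple : IsSimpleModule A (M ⧸ N) := isSimpleModule_iff_isCoatom.2 hN
    obtain ⟨I, hI, ⟨e⟩⟩ := isSimpleModule_iff_quot_maximal.1 hsimple
    obtain rfl := IsLocalRing.eq_maximalIdeal hI
    have h1 : Module.finrank k (M ⧸ N) = 1 := by
      rw [(e.restrictScalars k).finrank_eq, finrank_quotient_maximalIdeal_eq_one hres]
    have h2 := Submodule.finrank_quotient_add_finrank (N.restrictScalars k)
    have h3 : Module.finrank k (M ⧸ N.restrictScalars k) = Module.finrank k (M ⧸ N) :=
      (Submodule.Quotient.restrictScalarsEquiv k N).finrank_eq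
    have h4 : Module.finrank k N + 1 = Module.finrank k M := by
      have : Module.finrank k (N.restrictScalars k) = Module.finrank k N := rfl
      omega
    have : Module.Finite k N := inferInstanceAs (Module.Finite k (N.restrictScalars k))
    rw [Module.length_eq_add_of_exact N.subtype N.mkQ N.injective_subtype N.mkQ_surjective
      (LinearMap.exact_subtype_mkQ N), ih N (by omega), Module.length_eq_one, ← h4]
    rfl

end Length

/-! ### Translation from S/(f) to ideals of S. -/

section Hypersurface

variable {k : Type*} [Field k] {n : ℕ}

theorem map_frobeniusPower {A B : Type*} [CommRing A] [CommRing B] (φ : A →+* B)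
    (hφ : Function.Surjective φ) (J : Ideal A) (q : ℕ) :
    (frobeniusPower J q).map φ = frobeniusPower (J.map φ) q := by
  rw [frobeniusPower, frobeniusPower, Ideal.map_span]
  congr 1
  ext y
  simp only [Set.mem_image, SetLike.mem_coe, Ideal.mem_map_iff_of_surjective φ hφ]
  constructor
  · rintro ⟨_, ⟨x, hx, rfl⟩, rfl⟩
    exact ⟨φ x, ⟨x, hx, rfl⟩, (map_pow φ x q).symm⟩
  · rintro ⟨_, ⟨x, hx, rfl⟩, rfl⟩
    exact ⟨x ^ q, ⟨x, hx, rfl⟩, map_pow φ x q⟩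

theorem pow_mem_frobeniusPower {A : Type*} [CommRing A] {J : Ideal A} {x : A} (hx : x ∈ J)
    (q : ℕ) : x ^ q ∈ frobeniusPower J q :=
  Ideal.subset_span ⟨x, hx, rfl⟩

theorem frobeniusPower_le_iff {A : Type*} [CommRing A] {J K : Ideal A} {q : ℕ} :
    frobeniusPower J q ≤ K ↔ ∀ x ∈ J, x ^ q ∈ K := by
  rw [frobeniusPower, Ideal.span_le]
  exact ⟨fun h x hx => h ⟨x, hx, rfl⟩, by rintro h _ ⟨x, hx, rfl⟩; exact h x hx⟩

theorem map_maximalIdeal_of_surjective {A B : Type*} [CommRing A] [CommRing B] [IsLocalRing A]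
    [IsLocalRing B] (φ : A →+* B) (hφ : Function.Surjective φ) :
    (IsLocalRing.maximalIdeal A).map φ = IsLocalRing.maximalIdeal B := by
  rcases Ideal.map_eq_top_or_isMaximal_of_surjective φ hφ
    (IsLocalRing.maximalIdeal.isMaximal A) with h | h
  · obtain ⟨y, hy, h1⟩ := (Ideal.mem_map_iff_of_surjective φ hφ).1
      (h ▸ Submodule.mem_top : (1 : B) ∈ _)
    have hu := (IsLocalRing.isUnit_one_sub_self_of_mem_nonunits y hy).map φ
    rw [map_sub, map_one, h1, sub_self] at hu
    exact absurd hu not_isUnit_zero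
  · exact IsLocalRing.eq_maximalIdeal h

/-- The ideal `𝔪^a + 𝔪^[q]` of the power series ring. -/
def mixedPower (k : Type*) [Field k] (n a q : ℕ) : Ideal (MvPowerSeries (Fin (n + 1)) k) :=
  IsLocalRing.maximalIdeal _ ^ a ⊔ frobeniusPower (IsLocalRing.maximalIdeal _) q

instance moduleFinite_quotient_mixedPower (a q : ℕ) :
    Module.Finite k (MvPowerSeries (Fin (n + 1)) k ⧸ mixedPower k n a q) :=
  moduleFinite_quotient_of_le
    (I := IsLocalRing.maximalIdeal (MvPowerSeries (Fin (n + 1)) k) ^ a) le_sup_left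

/-- This removes the ring S/(f), and its own maximal ideal, from all later estimates. -/
theorem length_hypersurface_quotient (f : MvPowerSeries (Fin (n + 1)) k)
    [IsLocalRing (MvPowerSeries (Fin (n + 1)) k ⧸ Ideal.span {f})] (a q : ℕ) :
    (Module.length (MvPowerSeries (Fin (n + 1)) k ⧸ Ideal.span {f})
      ((MvPowerSeries (Fin (n + 1)) k ⧸ Ideal.span {f}) ⧸
        (IsLocalRing.maximalIdeal (MvPowerSeries (Fin (n + 1)) k ⧸ Ideal.span {f}) ^ a ⊔
          frobeniusPower (IsLocalRing.maximalIdeal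
            (MvPowerSeries (Fin (n + 1)) k ⧸ Ideal.span {f})) q))).toNat =
    Module.finrank k
      (MvPowerSeries (Fin (n + 1)) k ⧸ (Ideal.span {f} ⊔ mixedPower k n a q)) := by
  set π := Ideal.Quotient.mk (Ideal.span {f})
  have hπ : Function.Surjective π := Ideal.Quotient.mk_surjective
  have hm := map_maximalIdeal_of_surjective π hπ
  have hJ : IsLocalRing.maximalIdeal (MvPowerSeries (Fin (n + 1)) k ⧸ Ideal.span {f}) ^ a ⊔
      frobeniusPower (IsLocalRing.maximalIdeal (MvPowerSeries (Fin (n + 1)) k ⧸ Ideal.span {f})) q =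
      (mixedPower k n a q).map π := by
    rw [mixedPower, Ideal.map_sup, Ideal.map_pow, map_frobeniusPower π hπ, hm]
  rw [hJ]
  have e := DoubleQuot.quotQuotEquivQuotSupₐ k (Ideal.span {f}) (mixedPower k n a q)
  have : Module.Finite k (MvPowerSeries (Fin (n + 1)) k ⧸ (Ideal.span {f} ⊔ mixedPower k n a q)) :=
    moduleFinite_quotient_of_le (I := mixedPower k n a q) le_sup_right
  have : Module.Finite k ((MvPowerSeries (Fin (n + 1)) k ⧸ Ideal.span {f}) ⧸ (mixedPower k n a q).map π) :=
    Module.Finite.equiv e.symm.toLinearEquiv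
  rw [length_eq_finrank_of_residue (k := k), ENat.toNat_natCast]
  · exact e.toLinearEquiv.finrank_eq
  · intro y
    obtain ⟨x, rfl⟩ := hπ y
    refine ⟨MvPowerSeries.constantCoeff x, ?_⟩
    rw [← hm]
    have : π x - algebraMap k (MvPowerSeries (Fin (n + 1)) k ⧸ Ideal.span {f}) (MvPowerSeries.constantCoeff x) =
        π (x - MvPowerSeries.C (MvPowerSeries.constantCoeff x)) := by
      rw [map_sub]
      rfl
    rw [this]
    refine Ideal.mem_map_of_mem π (MvPowerSeries.mem_maximalIdeal_iff.2 ?_)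
    simp

theorem maximalIdeal_eq_span_range_X (k : Type*) [Field k] (m : ℕ) :
    IsLocalRing.maximalIdeal (MvPowerSeries (Fin m) k) =
      Ideal.span (Set.range MvPowerSeries.X) := by
  refine le_antisymm (fun f hf => ?_) ?_
  · rw [← pow_one (IsLocalRing.maximalIdeal _), MvPowerSeries.mem_maximalIdeal_pow_iff] at hf
    obtain ⟨F, rfl, -⟩ := MvPowerSeries.exists_eq_sum_X_mul (a := 0) hf
    exact Ideal.sum_mem _ fun i _ => Ideal.mul_mem_right _ _ (Ideal.subset_span ⟨i, rfl⟩)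
  · rw [Ideal.span_le]
    rintro _ ⟨i, rfl⟩
    exact MvPowerSeries.X_mem_maximalIdeal i

theorem ringKrullDim_mvPowerSeries (k : Type*) [Field k] (m : ℕ) :
    ringKrullDim (MvPowerSeries (Fin m) k) = m := by
  refine le_antisymm ?_ ?_
  -- Upper bound: the variables generate 𝔪. The lower bound adjoins one variable at a time.
  · refine (ringKrullDim_le_spanFinrank_maximalIdeal _).trans ?_
    rw [maximalIdeal_eq_span_range_X]
    have h := Submodule.spanFinrank_span_le_ncard_of_finite (R := MvPowerSeries (Fin m) k)
      (Set.finite_range (MvPowerSeries.X : Fin m → MvPowerSeries (Fin m) k))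
    rw [← Set.image_univ] at h ⊢
    have h2 := h.trans (Set.ncard_image_le (Set.finite_univ))
    rw [Set.ncard_univ, Nat.card_eq_fintype_card, Fintype.card_fin] at h2
    exact_mod_cast h2
  · induction m with
    | zero => exact ringKrullDim_nonneg_of_nontrivial
    | succ m ih =>
      rw [ringKrullDim_eq_of_ringEquiv (MvPowerSeries.finSuccEquiv k m).toRingEquiv]
      refine le_trans ?_ ringKrullDim_succ_le_ringKrullDim_powerseries
      push_cast
      gcongr

theorem dimNat_hypersurface {f : MvPowerSeries (Fin (n + 1)) k}
    (hf : f ∈ IsLocalRing.maximalIdeal (MvPowerSeries (Fin (n + 1)) k)) (hf0 : f ≠ 0) :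
    dimNat (MvPowerSeries (Fin (n + 1)) k ⧸ Ideal.span {f}) = n := by
  have h := ringKrullDim_quotient_span_singleton_succ_eq_ringKrullDim_of_mem_nonZeroDivisors
    (mem_nonZeroDivisors_of_ne_zero hf0) hf
  rw [ringKrullDim_mvPowerSeries] at h
  have h' : ringKrullDim (MvPowerSeries (Fin (n + 1)) k ⧸ Ideal.span {f}) = n := by
    push_cast at h
    exact ENat.WithBot.add_one_cancel.1 h
  rw [dimNat, h']
  rfl

theorem normalizedColength_hypersurface {f : MvPowerSeries (Fin (n + 1)) k}
    (hf : f ∈ IsLocalRing.maximalIdeal (MvPowerSeries (Fin (n + 1)) k)) (hf0 : f ≠ 0)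
    [IsLocalRing (MvPowerSeries (Fin (n + 1)) k ⧸ Ideal.span {f})] (p : ℕ) (s : ℝ) (e : ℕ) :
    normalizedColength p s
      (IsLocalRing.maximalIdeal (MvPowerSeries (Fin (n + 1)) k ⧸ Ideal.span {f}))
      (IsLocalRing.maximalIdeal (MvPowerSeries (Fin (n + 1)) k ⧸ Ideal.span {f})) e =
    (Module.finrank k (MvPowerSeries (Fin (n + 1)) k ⧸
      (Ideal.span {f} ⊔ mixedPower k n ⌈s * (p : ℝ) ^ e⌉₊ (p ^ e))) : ℝ) /
      ((p : ℝ) ^ e) ^ n := by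
  rw [normalizedColength, length_hypersurface_quotient, dimNat_hypersurface hf hf0, pow_mul]

end Hypersurface

/-! ### Decomposition over the p-th powers and the Frobenius inequality. -/

section FrobeniusTrace

open MvPowerSeries

variable {k : Type*} [Field k] (p : ℕ) [Fact p.Prime] [CharP k p] {m : ℕ}

theorem MvPowerSeries.coeff_pow_char_smul (t : MvPowerSeries (Fin m) k) (v : Fin m →₀ ℕ) :
    coeff (p • v) (t ^ p) = coeff v t ^ p := by
  rw [← map_frobenius_expand p (Fact.out : p.Prime).ne_zero, coeff_map, coeff_expand_smul,
    frobenius_def]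

theorem MvPowerSeries.coeff_pow_char_of_not_dvd (t : MvPowerSeries (Fin m) k) {v : Fin m →₀ ℕ}
    {i : Fin m} (h : ¬ p ∣ v i) : coeff v (t ^ p) = 0 := by
  rw [← map_frobenius_expand p (Fact.out : p.Prime).ne_zero, coeff_map,
    coeff_expand_of_not_dvd _ _ _ h, map_zero]

variable [PerfectRing k p]

/-- The component of a power series along `x^u` in the decomposition over the subring of
`p`-th powers, followed by the inverse of Frobenius. -/
def frobeniusComponent (u : Fin m →₀ ℕ) :
    MvPowerSeries (Fin m) k →+ MvPowerSeries (Fin m) k where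
  toFun h := fun v => (frobeniusEquiv k p).symm (coeff (p • v + u) h)
  map_zero' := by
    ext v
    exact map_zero (frobeniusEquiv k p).symm
  map_add' a b := by
    ext v
    change (frobeniusEquiv k p).symm (coeff (p • v + u) (a + b)) =
      (frobeniusEquiv k p).symm _ + (frobeniusEquiv k p).symm _
    rw [map_add, map_add]

theorem coeff_frobeniusComponent_pow (u v : Fin m →₀ ℕ) (h : MvPowerSeries (Fin m) k) :
    coeff v (frobeniusComponent p u h) ^ p = coeff (p • v + u) h :=
  frobenius_apply_frobeniusEquiv_symm k p _

/-- The component maps are p⁻¹-linear: p-th powers come out as their p-th roots. This is what sends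
K^[p] back into K. -/
theorem frobeniusComponent_mul_pow {u : Fin m →₀ ℕ} (hu : ∀ i, u i < p)
    (s t : MvPowerSeries (Fin m) k) :
    frobeniusComponent p u (s * t ^ p) = frobeniusComponent p u s * t := by
  classical
  have hp0 : p ≠ 0 := (Fact.out : p.Prime).ne_zero
  ext v
  apply frobenius_inj k p
  rw [frobenius_def, frobenius_def, coeff_frobeniusComponent_pow, coeff_mul, coeff_mul,
    sum_pow_char]
  simp_rw [mul_pow, coeff_frobeniusComponent_pow]
  symm
  -- Only exponents divisible by p occur in t ^ p, so the nonzero terms on the right are indexed by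
  -- the splittings of v.
  refine Finset.sum_of_injOn (fun x => (p • x.1 + u, p • x.2)) ?_ ?_ ?_ ?_
  · rintro ⟨a, b⟩ _ ⟨a', b'⟩ _ h
    simp only [Prod.mk.injEq, add_left_inj] at h
    rw [nsmul_right_inj hp0, nsmul_right_inj hp0] at h
    rw [h.1, h.2]
  · rintro ⟨a, b⟩ h
    simp only [Finset.mem_coe, Finset.HasAntidiagonal.mem_antidiagonal] at h ⊢
    rw [← h, smul_add]
    abel
  · rintro ⟨a, b⟩ h hnot
    rw [Finset.HasAntidiagonal.mem_antidiagonal] at h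
    by_cases hb : ∀ i, p ∣ b i
    · exfalso
      apply hnot
      choose c hc using hb
      obtain ⟨b', rfl⟩ : ∃ b' : Fin m →₀ ℕ, b = p • b' :=
        ⟨Finsupp.equivFunOnFinite.symm c, by ext i; simp [hc i]⟩
      -- From a + p b' = p v + u with all u i < p, no coordinate of b' can exceed that of v.
      have hle : b' ≤ v := by
        intro i
        have h1 := DFunLike.congr_fun h i
        simp only [Finsupp.add_apply, Finsupp.smul_apply, smul_eq_mul] at h1
        have h2 := hu i
        by_contra hlt
        have h3 : p * (v i + 1) ≤ p * b' i := Nat.mul_le_mul_left p (by omega)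
        rw [mul_add, mul_one] at h3
        omega
      refine ⟨(v - b', b'), ?_, ?_⟩
      · simp [tsub_add_cancel_of_le hle]
      · simp only [Prod.mk.injEq, and_true]
        apply add_right_cancel (b := p • b')
        rw [h, add_right_comm, ← smul_add, tsub_add_cancel_of_le hle]
    · push Not at hb
      obtain ⟨i, hi⟩ := hb
      rw [coeff_pow_char_of_not_dvd p t hi, mul_zero]
  · rintro ⟨a, b⟩ _
    rw [coeff_pow_char_smul]

theorem frobeniusComponent_mem {u : Fin m →₀ ℕ} (hu : ∀ i, u i < p)
    {K : Ideal (MvPowerSeries (Fin m) k)} {h : MvPowerSeries (Fin m) k}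
    (hh : h ∈ frobeniusPower K p) : frobeniusComponent p u h ∈ K := by
  -- The component map is not S-linear, so the induction must carry an arbitrary multiplier r.
  suffices ∀ r, frobeniusComponent p u (r * h) ∈ K by simpa using this 1
  rw [frobeniusPower] at hh
  induction hh using Submodule.span_induction with
  | mem x hx =>
    obtain ⟨t, ht, rfl⟩ := hx
    intro r
    rw [frobeniusComponent_mul_pow p hu]
    exact K.mul_mem_left _ ht
  | zero => intro r; rw [mul_zero, map_zero]; exact K.zero_mem
  | add x y _ _ hx hy => intro r; rw [mul_add, map_add]; exact K.add_mem (hx r) (hy r)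
  | smul a x _ hx => intro r; rw [smul_eq_mul, ← mul_assoc]; exact hx _

theorem frobeniusComponent_monomial_mul_pow {u w : Fin m →₀ ℕ} (hu : ∀ i, u i < p)
    (hw : ∀ i, w i < p) (c : k) (t : MvPowerSeries (Fin m) k) :
    frobeniusComponent p u (monomial w (c ^ p) * t ^ p) = if u = w then c • t else 0 := by
  classical
  rw [frobeniusComponent_mul_pow p hu]
  have : frobeniusComponent p u (monomial w (c ^ p)) = if u = w then C c else 0 := by
    ext v
    apply frobenius_inj k p
    rw [frobenius_def, frobenius_def, coeff_frobeniusComponent_pow, coeff_monomial]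
    have hiff : p • v + u = w ↔ v = 0 ∧ u = w := by
      refine ⟨fun h => ?_, fun ⟨h1, h2⟩ => by simp [h1, h2]⟩
      have hv : v = 0 := by
        ext i
        have h1 := DFunLike.congr_fun h i
        simp only [Finsupp.add_apply, Finsupp.smul_apply, smul_eq_mul] at h1
        have h2 := hw i
        by_contra h0
        have : p * 1 ≤ p * v i := Nat.mul_le_mul_left p (Nat.one_le_iff_ne_zero.2 h0)
        omega
      refine ⟨hv, ?_⟩
      simpa [hv] using h
    have hp0 : p ≠ 0 := (Fact.out : p.Prime).ne_zero
    by_cases h1 : u = w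
    · by_cases h2 : v = 0
      · rw [if_pos (hiff.2 ⟨h2, h1⟩), if_pos h1, h2]
        simp
      · rw [if_neg (fun h => h2 (hiff.1 h).1), if_pos h1, coeff_C, if_neg h2, zero_pow hp0]
    · rw [if_neg (fun h => h1 (hiff.1 h).2), if_neg h1, map_zero, zero_pow hp0]
  rw [this]
  split_ifs
  · rw [smul_eq_C_mul]
  · rw [zero_mul]

/-- Passing to a Frobenius power multiplies the colength by (at least) `p ^ dim`. -/
theorem pow_mul_finrank_le_finrank_frobeniusPower (K : Ideal (MvPowerSeries (Fin m) k))
    [Module.Finite k (MvPowerSeries (Fin m) k ⧸ K)]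
    [Module.Finite k (MvPowerSeries (Fin m) k ⧸ frobeniusPower K p)] :
    p ^ m * Module.finrank k (MvPowerSeries (Fin m) k ⧸ K) ≤
      Module.finrank k (MvPowerSeries (Fin m) k ⧸ frobeniusPower K p) := by
  classical
  set B := Module.finBasis k (MvPowerSeries (Fin m) k ⧸ K) with hB
  choose b hb using fun i => Ideal.Quotient.mk_surjective (B i)
  let ex : (Fin m → Fin p) → (Fin m →₀ ℕ) :=
    fun u => Finsupp.equivFunOnFinite.symm fun i => (u i : ℕ)
  have hex : ∀ u i, ex u i < p := fun u i => (u i).2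
  have hexinj : Function.Injective ex := fun u v h => by
    ext i
    exact DFunLike.congr_fun h i
  let w : (Fin m → Fin p) × Fin (Module.finrank k (MvPowerSeries (Fin m) k ⧸ K)) →
      MvPowerSeries (Fin m) k ⧸ frobeniusPower K p :=
    fun x => Ideal.Quotient.mk _ (monomial (ex x.1) 1 * b x.2 ^ p)
  -- The products x^u b_i^p, with all exponents of u below p, are independent modulo K^[p]. Taking
  -- p-th roots of the coefficients of a relation and applying the component along u gives a
  -- relation among the basis vectors of S/K.
  have hw : LinearIndependent k w := by
    rw [Fintype.linearIndependent_iff]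
    intro c hc
    choose γ hγ using fun x => (frobeniusEquiv k p).surjective (c x)
    have hγ' : ∀ x, c x = γ x ^ p := fun x => (hγ x).symm
    have hmem : ∑ x, monomial (ex x.1) (γ x ^ p) * b x.2 ^ p ∈ frobeniusPower K p := by
      rw [← Ideal.Quotient.eq_zero_iff_mem, map_sum, ← hc]
      refine Finset.sum_congr rfl fun x _ => ?_
      have : monomial (ex x.1) (γ x ^ p) = (c x) • (monomial (ex x.1) (1 : k)) := by
        rw [← map_smul, smul_eq_mul, mul_one, hγ']
      rw [this, smul_mul_assoc]
      rfl
    have hcomp : ∀ u : Fin m → Fin p, ∑ i, γ (u, i) • b i ∈ K := by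
      intro u
      have h := frobeniusComponent_mem p (hex u) hmem
      rw [map_sum, Fintype.sum_prod_type] at h
      simp_rw [frobeniusComponent_monomial_mul_pow p (hex u) (hex _), hexinj.eq_iff] at h
      rwa [Finset.sum_eq_single u, Finset.sum_congr rfl (fun i _ => if_pos rfl)] at h
      · intro v _ hv
        exact Finset.sum_eq_zero fun i _ => if_neg hv.symm
      · simp
    rintro ⟨u, i⟩
    have h := hcomp u
    rw [← Ideal.Quotient.eq_zero_iff_mem, map_sum] at h
    have h2 : ∑ i, γ (u, i) • B i = 0 := by
      rw [← h]
      refine Finset.sum_congr rfl fun i _ => ?_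
      rw [← hb i]
      rfl
    have h3 := Fintype.linearIndependent_iff.1 B.linearIndependent (fun i => γ (u, i)) h2 i
    rw [hγ', h3, zero_pow (Fact.out : p.Prime).ne_zero]
  have h := hw.fintype_card_le_finrank
  rwa [Fintype.card_prod, Fintype.card_fun, Fintype.card_fin, Fintype.card_fin,
    Fintype.card_fin] at h

/-- The Frobenius inequality for the colengths of a hypersurface. -/
theorem pow_mul_finrank_le_finrank_span_sup_frobeniusPower {n : ℕ}
    (f : MvPowerSeries (Fin (n + 1)) k) (J : Ideal (MvPowerSeries (Fin (n + 1)) k))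
    [Module.Finite k (MvPowerSeries (Fin (n + 1)) k ⧸ J)]
    [Module.Finite k (MvPowerSeries (Fin (n + 1)) k ⧸ frobeniusPower J p)] :
    p ^ n * Module.finrank k (MvPowerSeries (Fin (n + 1)) k ⧸ (Ideal.span {f} ⊔ J)) ≤
      Module.finrank k
        (MvPowerSeries (Fin (n + 1)) k ⧸ (Ideal.span {f} ⊔ frobeniusPower J p)) := by
  have hle : Ideal.span {f ^ p} ⊔ frobeniusPower J p ≤
      frobeniusPower (Ideal.span {f} ⊔ J) p := by
    refine sup_le ?_ (frobeniusPower_le_iff.2 fun x hx =>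
      pow_mem_frobeniusPower (Ideal.mem_sup_right hx) p)
    rw [Ideal.span_singleton_le_iff_mem]
    exact pow_mem_frobeniusPower (Ideal.mem_sup_left (Ideal.mem_span_singleton_self f)) p
  have : Module.Finite k (MvPowerSeries (Fin (n + 1)) k ⧸ (Ideal.span {f} ⊔ J)) :=
    moduleFinite_quotient_of_le (I := J) le_sup_right
  have : Module.Finite k
      (MvPowerSeries (Fin (n + 1)) k ⧸ (Ideal.span {f ^ p} ⊔ frobeniusPower J p)) :=
    moduleFinite_quotient_of_le (I := frobeniusPower J p) le_sup_right
  have : Module.Finite k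
      (MvPowerSeries (Fin (n + 1)) k ⧸ frobeniusPower (Ideal.span {f} ⊔ J) p) :=
    moduleFinite_quotient_of_le hle
  have h1 := pow_mul_finrank_le_finrank_frobeniusPower p (Ideal.span {f} ⊔ J)
  have h2 := finrank_quotient_le_of_le (k := k) hle
  -- Replacing f ^ p by f costs a factor p, which turns p^(n+1) into p^n.
  have h3 := finrank_quotient_span_pow_le (k := k) f (frobeniusPower J p) p
  have h4 := h1.trans (h2.trans h3)
  rw [pow_succ', mul_assoc] at h4
  exact Nat.le_of_mul_le_mul_left h4 (Fact.out : p.Prime).pos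

end FrobeniusTrace

/-! ### Mixed powers inside Frobenius powers. -/

section FrobeniusContainment

variable {k : Type*} [Field k]

open MvPowerSeries

theorem maximalIdeal_pow_le_span_monomial (m b : ℕ) :
    IsLocalRing.maximalIdeal (MvPowerSeries (Fin m) k) ^ b ≤
      Ideal.span {x | ∃ w : Fin m →₀ ℕ, w.degree = b ∧ x = monomial w 1} := by
  induction b with
  | zero =>
    rw [pow_zero, Ideal.one_eq_top, top_le_iff, Ideal.eq_top_iff_one]
    exact Ideal.subset_span ⟨0, by simp, rfl⟩
  | succ b ih =>
    rw [pow_succ]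
    refine (Ideal.mul_mono_left ih).trans ?_
    rw [maximalIdeal_eq_span_range_X, Ideal.span_mul_span', Ideal.span_le]
    rintro _ ⟨_, ⟨w, hw, rfl⟩, _, ⟨i, rfl⟩, rfl⟩
    refine Ideal.subset_span ⟨w + Finsupp.single i 1, by simp [hw], ?_⟩
    simp [X_def, monomial_mul_monomial]

/-- Large powers of the maximal ideal lie in Frobenius powers of its smaller powers. -/
theorem maximalIdeal_pow_le_frobeniusPower (m p a : ℕ) (hp : 0 < p) :
    IsLocalRing.maximalIdeal (MvPowerSeries (Fin m) k) ^ (p * a + m * p) ≤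
      frobeniusPower (IsLocalRing.maximalIdeal (MvPowerSeries (Fin m) k) ^ a) p := by
  refine (maximalIdeal_pow_le_span_monomial _ _).trans ?_
  rw [Ideal.span_le]
  rintro _ ⟨w, hw, rfl⟩
  -- Divide the exponent by p coordinatewise: the remainders have total degree at most m p, so the
  -- quotient has degree at least a.
  obtain ⟨v, hv⟩ : ∃ v : Fin m →₀ ℕ, ∀ i, v i = w i / p :=
    ⟨Finsupp.equivFunOnFinite.symm fun i => w i / p, fun i => rfl⟩
  obtain ⟨u, hu⟩ : ∃ u : Fin m →₀ ℕ, ∀ i, u i = w i % p :=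
    ⟨Finsupp.equivFunOnFinite.symm fun i => w i % p, fun i => rfl⟩
  have hwuv : w = u + p • v := by
    ext i
    simp [hu, hv, Nat.mod_add_div]
  have hudeg : u.degree ≤ m * p := by
    rw [Finsupp.degree_eq_sum]
    refine (Finset.sum_le_card_nsmul _ _ p fun i _ => ?_).trans (by simp)
    rw [hu]
    exact (Nat.mod_lt _ hp).le
  have hvdeg : a ≤ v.degree := by
    rw [hwuv, map_add, map_nsmul, smul_eq_mul] at hw
    exact Nat.le_of_mul_le_mul_left (by omega : p * a ≤ p * v.degree) hp
  have hmon : (monomial w (1 : k)) = monomial u 1 * monomial v 1 ^ p := by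
    rw [monomial_pow, one_pow, monomial_mul_monomial, one_mul, hwuv]
  rw [SetLike.mem_coe, hmon]
  refine Ideal.mul_mem_left _ _ (pow_mem_frobeniusPower (mem_maximalIdeal_pow_iff.2 ?_) p)
  intro d hd
  classical
  rw [coeff_monomial, if_neg]
  rintro rfl
  omega

theorem frobeniusPower_mul_le {A : Type*} [CommRing A] (J : Ideal A) (q p : ℕ) :
    frobeniusPower J (q * p) ≤ frobeniusPower (frobeniusPower J q) p := by
  rw [frobeniusPower_le_iff]
  intro x hx
  rw [pow_mul]
  exact pow_mem_frobeniusPower (pow_mem_frobeniusPower hx q) p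

theorem mixedPower_le_frobeniusPower (n p a b q : ℕ) (hp : 0 < p)
    (hb : p * a + (n + 1) * p ≤ b) :
    mixedPower k n b (q * p) ≤ frobeniusPower (mixedPower k n a q) p := by
  have hmono : ∀ {I J : Ideal (MvPowerSeries (Fin (n + 1)) k)}, I ≤ J →
      frobeniusPower I p ≤ frobeniusPower J p := fun h =>
    frobeniusPower_le_iff.2 fun x hx => pow_mem_frobeniusPower (h hx) p
  refine sup_le ?_ ?_
  · exact (Ideal.pow_le_pow_right hb).trans
      ((maximalIdeal_pow_le_frobeniusPower _ p a hp).trans (hmono le_sup_left))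
  · exact (frobeniusPower_mul_le _ q p).trans (hmono le_sup_right)

/-- A power of the maximal ideal lies in its Frobenius power. -/
theorem maximalIdeal_pow_le_mixedPower (n a q : ℕ) (hq : 0 < q) :
    IsLocalRing.maximalIdeal (MvPowerSeries (Fin (n + 1)) k) ^ ((n + 2) * q) ≤
      mixedPower k n a q := by
  have h := maximalIdeal_pow_le_frobeniusPower (k := k) (n + 1) q 1 hq
  rw [pow_one, mul_one, show q + (n + 1) * q = (n + 2) * q by ring] at h
  exact h.trans le_sup_right

end FrobeniusContainment

/-- A bounded sequence of reals that is increasing up to a geometric error converges. -/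
theorem exists_tendsto_of_le_add_geometric {x : ℕ → ℝ} {B D ρ : ℝ} (hρ0 : 0 ≤ ρ) (hρ1 : ρ < 1)
    (hB : ∀ e, x e ≤ B) (hD : 0 ≤ D) {N : ℕ}
    (hx : ∀ e, N ≤ e → x e ≤ x (e + 1) + D * ρ ^ e) : ∃ l, Tendsto x atTop (𝓝 l) := by
  have h1ρ : 0 < 1 - ρ := by linarith
  -- Subtracting the tail of the geometric error series makes the sequence monotone.
  let y : ℕ → ℝ := fun e => x (e + N) - D / (1 - ρ) * ρ ^ (e + N)
  have hmono : Monotone y := monotone_nat_of_le_succ fun e => by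
    have h := hx (e + N) (by omega)
    have h2 : D / (1 - ρ) * ρ ^ (e + N) - D / (1 - ρ) * ρ ^ (e + N + 1) = D * ρ ^ (e + N) := by
      rw [pow_succ]
      field_simp
    change x (e + N) - D / (1 - ρ) * ρ ^ (e + N) ≤
      x (e + 1 + N) - D / (1 - ρ) * ρ ^ (e + 1 + N)
    rw [show e + 1 + N = e + N + 1 by ring]
    linarith
  have hbdd : BddAbove (Set.range y) := by
    refine ⟨B, ?_⟩
    rintro _ ⟨e, rfl⟩
    have : 0 ≤ D / (1 - ρ) * ρ ^ (e + N) := by positivity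
    have := hB (e + N)
    change x (e + N) - D / (1 - ρ) * ρ ^ (e + N) ≤ B
    linarith
  have hy := tendsto_atTop_ciSup hmono hbdd
  have hgeo : Tendsto (fun e : ℕ => D / (1 - ρ) * ρ ^ (e + N)) atTop (𝓝 0) := by
    simpa using ((tendsto_pow_atTop_nhds_zero_of_lt_one hρ0 hρ1).comp
      (tendsto_add_atTop_nat N)).const_mul (D / (1 - ρ))
  refine ⟨(⨆ i, y i) + 0, (tendsto_add_atTop_iff_nat N).1 ?_⟩
  refine (hy.add hgeo).congr fun e => ?_
  simp [y]

/-! ### Growth of binomial coefficients. -/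

section Binomial

theorem choose_succ_mul (n b : ℕ) :
    (b + 1) * (n + (b + 1)).choose n = (b + 1) * (n + b).choose n + n * (n + b).choose n := by
  have h := Nat.add_one_mul_choose_eq (n + b) b
  rw [← Nat.choose_symm_add, Nat.choose_symm_of_eq_add (show n + b + 1 = b + 1 + n by ring)] at h
  rw [← add_assoc n b 1]
  linarith

theorem choose_add_mono (n : ℕ) {b c : ℕ} (h : b ≤ c) :
    (n + b).choose n ≤ (n + c).choose n :=
  Nat.choose_le_choose n (by omega)

/-- Each of the j increments is at most n/(b+1) times the last binomial coefficient; the form avoids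
division. -/
theorem mul_choose_add_le (n : ℕ) {b B : ℕ} (h : b ≤ B) (j : ℕ) :
    (b + 1) * (n + (B + j)).choose n ≤
      (b + 1) * (n + B).choose n + j * n * (n + (B + j)).choose n := by
  induction j with
  | zero => simp
  | succ j ih =>
    have h1 := choose_succ_mul n (B + j)
    have h2 : (n + (B + j)).choose n ≤ (n + (B + j + 1)).choose n :=
      choose_add_mono n (Nat.le_succ _)
    rw [← add_assoc B j 1]
    generalize (n + (B + j + 1)).choose n = y at *
    generalize (n + (B + j)).choose n = x at *
    obtain ⟨t, rfl⟩ := Nat.exists_eq_add_of_le h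
    have h3 : (b + 1) * y ≤ (b + 1) * x + n * x := by
      have : (t + j) * x ≤ (t + j) * y := Nat.mul_le_mul_left _ h2
      nlinarith
    have h4 : (j + 1) * n * x ≤ (j + 1) * n * y := Nat.mul_le_mul_left _ h2
    calc (b + 1) * y ≤ (b + 1) * x + n * x := h3
      _ ≤ (b + 1) * (n + (b + t)).choose n + j * n * x + n * x := by omega
      _ = (b + 1) * (n + (b + t)).choose n + (j + 1) * n * x := by ring
      _ ≤ _ := by omega

end Binomial

/-! ### Existence of the limit for a hypersurface. -/

section Limit

variable {k : Type*} [Field k] {n : ℕ}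

/-- The growth of the Hilbert–Samuel function of a hypersurface of order `r`. -/
theorem mul_finrank_hypersurface_add_le {f : MvPowerSeries (Fin (n + 1)) k} {r : ℕ}
    (hr : f.order = r) (b c : ℕ) :
    (b + 1) * Module.finrank k (MvPowerSeries (Fin (n + 1)) k ⧸ (Ideal.span {f} ⊔
      IsLocalRing.maximalIdeal (MvPowerSeries (Fin (n + 1)) k) ^ (b + r + c))) ≤
    (b + 1) * Module.finrank k (MvPowerSeries (Fin (n + 1)) k ⧸ (Ideal.span {f} ⊔
      IsLocalRing.maximalIdeal (MvPowerSeries (Fin (n + 1)) k) ^ (b + r))) +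
      r * (c * n * (n + (b + r + c)).choose n) := by
  rw [add_right_comm b r c, finrank_quotient_span_sup_maximalIdeal_pow hr,
    finrank_quotient_span_sup_maximalIdeal_pow hr, Finset.mul_sum, Finset.mul_sum]
  have : r * (c * n * (n + (b + c + r)).choose n) =
      ∑ i ∈ Finset.range r, c * n * (n + (b + c + r)).choose n := by simp
  rw [this, ← Finset.sum_add_distrib]
  refine Finset.sum_le_sum fun i hi => ?_
  rw [Finset.mem_range] at hi
  rw [add_right_comm b c i]
  refine (mul_choose_add_le n (Nat.le_add_right b i) c).trans ?_
  exact Nat.add_le_add_left (Nat.mul_le_mul_left _ (choose_add_mono n (by omega))) _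

/-- Comparison of the colengths at two consecutive Frobenius levels. -/
theorem pow_mul_finrank_add_le (p : ℕ) [Fact p.Prime] [CharP k p] [PerfectRing k p]
    (f : MvPowerSeries (Fin (n + 1)) k) {a b c q : ℕ} (h : p * a + (n + 1) * p ≤ b + c) :
    p ^ n * Module.finrank k
        (MvPowerSeries (Fin (n + 1)) k ⧸ (Ideal.span {f} ⊔ mixedPower k n a q)) +
      Module.finrank k (MvPowerSeries (Fin (n + 1)) k ⧸ (Ideal.span {f} ⊔
        IsLocalRing.maximalIdeal (MvPowerSeries (Fin (n + 1)) k) ^ b)) ≤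
    Module.finrank k
        (MvPowerSeries (Fin (n + 1)) k ⧸ (Ideal.span {f} ⊔ mixedPower k n b (q * p))) +
      Module.finrank k (MvPowerSeries (Fin (n + 1)) k ⧸ (Ideal.span {f} ⊔
        IsLocalRing.maximalIdeal (MvPowerSeries (Fin (n + 1)) k) ^ (b + c))) := by
  have hle := mixedPower_le_frobeniusPower (k := k) n p a (b + c) q (Fact.out : p.Prime).pos h
  have : Module.Finite k
      (MvPowerSeries (Fin (n + 1)) k ⧸ frobeniusPower (mixedPower k n a q) p) :=
    moduleFinite_quotient_of_le hle
  have h1 := pow_mul_finrank_le_finrank_span_sup_frobeniusPower p f (mixedPower k n a q)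
  have : Module.Finite k
      (MvPowerSeries (Fin (n + 1)) k ⧸ (Ideal.span {f} ⊔ mixedPower k n (b + c) (q * p))) :=
    moduleFinite_quotient_of_le (I := mixedPower k n (b + c) (q * p)) le_sup_right
  have h2 := finrank_quotient_le_of_le (k := k)
    (sup_le_sup_left hle (Ideal.span {f}))
  have : Module.Finite k (MvPowerSeries (Fin (n + 1)) k ⧸ (Ideal.span {f} ⊔
      IsLocalRing.maximalIdeal (MvPowerSeries (Fin (n + 1)) k) ^ (b + c))) :=
    moduleFinite_quotient_of_le
      (I := IsLocalRing.maximalIdeal (MvPowerSeries (Fin (n + 1)) k) ^ (b + c)) le_sup_right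
  -- Lowering the exponent from b + c to b loses no more colength in the presence of the Frobenius
  -- power than without it.
  have h3 := finrank_quotient_sup_add_le (k := k)
    (frobeniusPower (IsLocalRing.maximalIdeal (MvPowerSeries (Fin (n + 1)) k)) (q * p))
    (sup_le_sup_left (Ideal.pow_le_pow_right (I := IsLocalRing.maximalIdeal
      (MvPowerSeries (Fin (n + 1)) k)) (Nat.le_add_right b c)) (Ideal.span {f}))
  rw [sup_assoc, sup_assoc] at h3
  have h4 := h1.trans h2
  rw [mixedPower] at h4 ⊢
  rw [mixedPower]
  rw [mixedPower] at h4
  omega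

/-- The bound is uniform in a, because 𝔪^[q] alone contains 𝔪^((n+2)q). It bounds the normalized
sequence. -/
theorem finrank_hypersurface_mixedPower_le {f : MvPowerSeries (Fin (n + 1)) k} {r : ℕ}
    (hr : f.order = r) (a : ℕ) {q : ℕ} (hq : 0 < q) :
    Module.finrank k (MvPowerSeries (Fin (n + 1)) k ⧸ (Ideal.span {f} ⊔ mixedPower k n a q)) ≤
      r * ((2 * n + 2 + r) * q) ^ n := by
  have hle : Ideal.span {f} ⊔
      IsLocalRing.maximalIdeal (MvPowerSeries (Fin (n + 1)) k) ^ ((n + 2) * q + r) ≤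
      Ideal.span {f} ⊔ mixedPower k n a q :=
    sup_le_sup_left ((Ideal.pow_le_pow_right (Nat.le_add_right _ r)).trans
      (maximalIdeal_pow_le_mixedPower n a q hq)) _
  have : Module.Finite k (MvPowerSeries (Fin (n + 1)) k ⧸ (Ideal.span {f} ⊔
      IsLocalRing.maximalIdeal (MvPowerSeries (Fin (n + 1)) k) ^ ((n + 2) * q + r))) :=
    moduleFinite_quotient_of_le
      (I := IsLocalRing.maximalIdeal (MvPowerSeries (Fin (n + 1)) k) ^ ((n + 2) * q + r))
      le_sup_right
  refine (finrank_quotient_le_of_le hle).trans ?_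
  rw [finrank_quotient_span_sup_maximalIdeal_pow hr]
  refine (Finset.sum_le_card_nsmul _ _ (((2 * n + 2 + r) * q) ^ n) fun i hi => ?_).trans
    (by simp)
  rw [Finset.mem_range] at hi
  refine (Nat.choose_le_pow _ _).trans (Nat.pow_le_pow_left ?_ n)
  nlinarith

/-- The limit defining the `s`-multiplicity of a hypersurface exists. -/
theorem exists_tendsto_finrank_hypersurface (p : ℕ) [Fact p.Prime] [CharP k p]
    [PerfectRing k p] {f : MvPowerSeries (Fin (n + 1)) k} (hf0 : f ≠ 0) {s : ℝ} (hs : 0 < s) :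
    ∃ l : ℝ, Tendsto (fun e : ℕ => (Module.finrank k (MvPowerSeries (Fin (n + 1)) k ⧸
      (Ideal.span {f} ⊔ mixedPower k n ⌈s * (p : ℝ) ^ e⌉₊ (p ^ e))) : ℝ) / ((p : ℝ) ^ e) ^ n)
      atTop (𝓝 l) := by
  have hp : 1 < (p : ℝ) := by exact_mod_cast (Fact.out : p.Prime).one_lt
  have hp0 : 0 < (p : ℝ) := by linarith
  obtain ⟨r, hr⟩ : ∃ r : ℕ, f.order = r :=
    ⟨f.order.toNat, (MvPowerSeries.ne_zero_iff_order_finite.1 hf0).symm⟩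
  -- One p absorbs the rounding in the ceiling, and (n + 1) p is the loss in the Frobenius
  -- containment.
  obtain ⟨c, hc⟩ : ∃ c, c = (n + 2) * p := ⟨_, rfl⟩
  set K : ℝ := s + 1 + n + c with hK
  -- Beyond N one has 2r ≤ A, so A - r + 1 is at least sQ/2 and division by it gains a factor of
  -- order 1/Q.
  obtain ⟨N, hN⟩ : ∃ N : ℕ, 2 * (r : ℝ) / s ≤ (p : ℝ) ^ N :=
    ((tendsto_pow_atTop_atTop_of_one_lt hp).eventually_ge_atTop _).exists
  refine exists_tendsto_of_le_add_geometric (B := r * (2 * n + 2 + r) ^ n)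
    (D := 2 * r * (c * n) * K ^ n / s) (ρ := 1 / p) (N := N) (by positivity)
    ((div_lt_one hp0).2 hp) (fun e => ?_) (by positivity) (fun e he => ?_)
  · rw [div_le_iff₀ (by positivity), mul_assoc, ← mul_pow]
    exact_mod_cast finrank_hypersurface_mixedPower_le hr _ (pow_pos (Fact.out : p.Prime).pos e)
  · set Q : ℝ := (p : ℝ) ^ (e + 1) with hQ
    have hQ1 : 1 ≤ Q := one_le_pow₀ hp.le
    have hQ0 : 0 < Q := by linarith
    set A : ℕ := ⌈s * Q⌉₊ with hA
    have hA1 : s * Q ≤ A := Nat.le_ceil _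
    have hA2 : (A : ℝ) < s * Q + 1 := Nat.ceil_lt_add_one (by positivity)
    have hpa : p * ⌈s * (p : ℝ) ^ e⌉₊ + (n + 1) * p ≤ A + c := by
      have h1 : (⌈s * (p : ℝ) ^ e⌉₊ : ℝ) < s * (p : ℝ) ^ e + 1 :=
        Nat.ceil_lt_add_one (by positivity)
      have h2 : (p : ℝ) * ⌈s * (p : ℝ) ^ e⌉₊ ≤ A + p := by
        calc (p : ℝ) * ⌈s * (p : ℝ) ^ e⌉₊ ≤ p * (s * (p : ℝ) ^ e + 1) := by gcongr
          _ = s * Q + p := by rw [hQ, pow_succ]; ring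
          _ ≤ _ := by linarith
      have h3 : p * ⌈s * (p : ℝ) ^ e⌉₊ ≤ A + p := by exact_mod_cast h2
      rw [hc]
      linarith
    have hmain := pow_mul_finrank_add_le p f (q := p ^ e) hpa
    have h2r : 2 * (r : ℝ) ≤ A := by
      have h1 : (p : ℝ) ^ N ≤ Q := pow_le_pow_right₀ hp.le (by omega)
      have h2 := hN.trans h1
      rw [div_le_iff₀ hs] at h2
      linarith
    have hrA : 2 * r ≤ A := by exact_mod_cast h2r
    have hgrow := mul_finrank_hypersurface_add_le (k := k) (n := n) hr (A - r) c
    rw [Nat.sub_add_cancel (by omega : r ≤ A)] at hgrow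
    rw [← pow_succ] at hmain
    generalize Module.finrank k (MvPowerSeries (Fin (n + 1)) k ⧸
      (Ideal.span {f} ⊔ mixedPower k n ⌈s * (p : ℝ) ^ e⌉₊ (p ^ e))) = ℓ₀ at *
    generalize Module.finrank k (MvPowerSeries (Fin (n + 1)) k ⧸
      (Ideal.span {f} ⊔ mixedPower k n A (p ^ (e + 1)))) = ℓ₁ at *
    generalize Module.finrank k (MvPowerSeries (Fin (n + 1)) k ⧸ (Ideal.span {f} ⊔
      IsLocalRing.maximalIdeal (MvPowerSeries (Fin (n + 1)) k) ^ A)) = L₀ at *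
    generalize Module.finrank k (MvPowerSeries (Fin (n + 1)) k ⧸ (Ideal.span {f} ⊔
      IsLocalRing.maximalIdeal (MvPowerSeries (Fin (n + 1)) k) ^ (A + c))) = L₁ at *
    have hmain' : (p : ℝ) ^ n * ℓ₀ + L₀ ≤ ℓ₁ + L₁ := by exact_mod_cast hmain
    have hb : s * Q / 2 ≤ ((A - r : ℕ) : ℝ) + 1 := by
      rw [Nat.cast_sub (by omega)]
      linarith
    have hgrow' : (((A - r : ℕ) : ℝ) + 1) * (L₁ - L₀) ≤ r * (c * n) * (K * Q) ^ n := by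
      have h1 : ((n + (A + c)).choose n : ℝ) ≤ (K * Q) ^ n := by
        have h2 : ((n + (A + c)).choose n : ℝ) ≤ ((n + (A + c) : ℕ) : ℝ) ^ n := by
          exact_mod_cast Nat.choose_le_pow _ _
        refine h2.trans (pow_le_pow_left₀ (by positivity) ?_ n)
        push_cast
        have hn : (n : ℝ) ≤ n * Q := le_mul_of_one_le_right (by positivity) hQ1
        have hcQ : (c : ℝ) ≤ c * Q := le_mul_of_one_le_right (by positivity) hQ1
        rw [hK]
        linarith
      have h3 : (((A - r : ℕ) : ℝ) + 1) * L₁ ≤ (((A - r : ℕ) : ℝ) + 1) * L₀ +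
          r * (c * n * (n + (A + c)).choose n) := by exact_mod_cast hgrow
      have h4 : (r : ℝ) * (c * n * (n + (A + c)).choose n) ≤ r * (c * n) * (K * Q) ^ n := by
        rw [← mul_assoc]
        gcongr
      linarith
    have hdiff : (L₁ : ℝ) - L₀ ≤ 2 * r * (c * n) * (K * Q) ^ n / (s * Q) := by
      rw [le_div_iff₀ (by positivity)]
      rcases le_or_gt ((L₁ : ℝ) - L₀) 0 with h | h
      · exact (mul_nonpos_of_nonpos_of_nonneg h (by positivity)).trans (by positivity)
      · nlinarith
    have e0 : (ℓ₀ : ℝ) / ((p : ℝ) ^ e) ^ n = (p : ℝ) ^ n * ℓ₀ / Q ^ n := by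
      rw [hQ, pow_succ, mul_pow]
      field_simp
    have e1 : 2 * r * (c * n) * (K * Q) ^ n / (s * Q) / Q ^ n =
        2 * r * (c * n) * K ^ n / s * (1 / p) ^ (e + 1) := by
      rw [mul_pow, one_div, inv_pow, ← hQ]
      field_simp
    have e2 : (1 / p : ℝ) ^ (e + 1) ≤ (1 / p) ^ e :=
      pow_le_pow_of_le_one (by positivity) ((div_le_one hp0).2 hp.le) (Nat.le_succ e)
    calc (ℓ₀ : ℝ) / ((p : ℝ) ^ e) ^ n = (p : ℝ) ^ n * ℓ₀ / Q ^ n := e0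
      _ ≤ (ℓ₁ + 2 * r * (c * n) * (K * Q) ^ n / (s * Q)) / Q ^ n := by
        gcongr
        linarith
      _ = ℓ₁ / Q ^ n + 2 * r * (c * n) * K ^ n / s * (1 / p) ^ (e + 1) := by
        rw [add_div, e1]
      _ ≤ _ := by gcongr

end Limit

/-! ### Semicontinuity in a pencil. -/

section Semicontinuity

variable {k : Type*} [Field k]

/-- The kernel of `u + α v` is no bigger than that of `u`, for all but finitely many `α`. -/
theorem finite_setOf_finrank_ker_lt {V : Type*} [AddCommGroup V] [Module k V]
    [Module.Finite k V] (u v : V →ₗ[k] V) :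
    {α : k | Module.finrank k (LinearMap.ker u) <
      Module.finrank k (LinearMap.ker (u + α • v))}.Finite := by
  -- A generalized inverse w of u. Unless -α⁻¹ is an eigenvalue of w v, the map 1 - w u embeds the
  -- kernel of u + αv into that of u.
  obtain ⟨w, hw⟩ : ∃ w : V →ₗ[k] V, u ∘ₗ w ∘ₗ u = u := by
    obtain ⟨g, hg⟩ := u.rangeRestrict.exists_rightInverse_of_surjective u.range_rangeRestrict
    obtain ⟨w, hw⟩ := g.exists_extend
    refine ⟨w, LinearMap.ext fun x => ?_⟩
    have h1 : w (u x) = g (u.rangeRestrict x) := LinearMap.congr_fun hw (u.rangeRestrict x)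
    have h2 := LinearMap.congr_fun hg (u.rangeRestrict x)
    rw [LinearMap.comp_apply, LinearMap.comp_apply, h1]
    exact congrArg Subtype.val h2
  have hfin := (Module.End.finite_hasEigenvalue (R := k) (w ∘ₗ v : Module.End k V))
  refine (hfin.preimage (f := fun α : k => -α⁻¹) (fun a _ b _ h => ?_)).subset ?_
  · exact inv_injective (neg_injective h)
  intro α hα
  by_contra hev
  refine absurd (Set.mem_ofPred_eq ▸ hα) (not_lt.2 ?_)
  let P : V →ₗ[k] V := LinearMap.id - w ∘ₗ u
  have hP : ∀ x ∈ LinearMap.ker (u + α • v), P x ∈ LinearMap.ker u := fun x _ => by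
    have := LinearMap.congr_fun hw x
    simp only [LinearMap.comp_apply] at this
    simp [P, this]
  refine LinearMap.finrank_le_finrank_of_injective (f := P.restrict hP) ?_
  rw [← LinearMap.ker_eq_bot, LinearMap.ker_eq_bot']
  rintro ⟨x, hx⟩ h0
  have h1 : x = w (u x) := by
    have := congrArg Subtype.val h0
    simpa [P, sub_eq_zero] using this
  have h2 : u x = -(α • v x) := by
    rw [LinearMap.mem_ker] at hx
    exact eq_neg_of_add_eq_zero_left hx
  have h3 : x = -(α • w (v x)) := by
    rw [h2, map_neg, map_smul] at h1
    exact h1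
  by_contra hne
  have hx0 : x ≠ 0 := fun h => hne (Subtype.ext h)
  have hα0 : α ≠ 0 := fun h => hx0 (by rw [h3, h, zero_smul, neg_zero])
  apply hev
  refine Module.End.hasEigenvalue_of_hasEigenvector (x := x) ⟨?_, hx0⟩
  rw [Module.End.mem_eigenspace_iff]
  change w (v x) = -α⁻¹ • x
  conv_rhs => rw [h3]
  rw [smul_neg, neg_smul, neg_neg, inv_smul_smul₀ hα0]

/-- Upper semicontinuity of the colength in the pencil `f + α g`. -/
theorem finite_setOf_finrank_quotient_lt {A : Type*} [CommRing A] [Algebra k A] (f g : A)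
    (J : Ideal A) [Module.Finite k (A ⧸ J)] :
    {α : k | Module.finrank k (A ⧸ (Ideal.span {f} ⊔ J)) <
      Module.finrank k (A ⧸ (Ideal.span {f + α • g} ⊔ J))}.Finite := by
  let μ : A → (A ⧸ J →ₗ[k] A ⧸ J) := fun a => LinearMap.mulLeft k (Ideal.Quotient.mk J a)
  -- Kernel and cokernel of an endomorphism of a finite-dimensional space have equal dimension.
  have hμ : ∀ a : A, Module.finrank k (LinearMap.ker (μ a)) =
      Module.finrank k (A ⧸ (Ideal.span {a} ⊔ J)) := by
    intro a
    have hle : J ≤ Ideal.span {a} ⊔ J := le_sup_right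
    have h1 := (μ a).finrank_range_add_finrank_ker
    have h2 := (Ideal.Quotient.factorₐ k hle).toLinearMap.finrank_range_add_finrank_ker
    have h3 : LinearMap.ker (Ideal.Quotient.factorₐ k hle).toLinearMap =
        LinearMap.range (μ a) := by
      ext y
      obtain ⟨b, rfl⟩ := Ideal.Quotient.mk_surjective y
      have e1 : Ideal.Quotient.mk J b ∈
          LinearMap.ker (Ideal.Quotient.factorₐ k hle).toLinearMap ↔ b ∈ Ideal.span {a} ⊔ J := by
        rw [LinearMap.mem_ker]
        exact Ideal.Quotient.eq_zero_iff_mem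
      rw [e1, Ideal.mem_span_singleton_sup]
      constructor
      · rintro ⟨z, c, hc, rfl⟩
        refine ⟨Ideal.Quotient.mk J z, ?_⟩
        change Ideal.Quotient.mk J a * Ideal.Quotient.mk J z = _
        rw [map_add, Ideal.Quotient.eq_zero_iff_mem.2 hc, add_zero, map_mul, mul_comm]
      · rintro ⟨z, hz⟩
        obtain ⟨z, rfl⟩ := Ideal.Quotient.mk_surjective z
        change Ideal.Quotient.mk J a * Ideal.Quotient.mk J z = _ at hz
        rw [← map_mul, Ideal.Quotient.eq] at hz
        exact ⟨z, -(a * z - b), J.neg_mem hz, by ring⟩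
    rw [h3, LinearMap.range_eq_top.2 (Ideal.Quotient.factor_surjective hle), finrank_top] at h2
    omega
  refine (finite_setOf_finrank_ker_lt (μ f) (μ g)).subset fun α hα => ?_
  have hadd : μ f + α • μ g = μ (f + α • g) := by
    refine LinearMap.ext fun y => ?_
    change Ideal.Quotient.mk J f * y + α • (Ideal.Quotient.mk J g * y) =
      Ideal.Quotient.mk J (f + α • g) * y
    have : Ideal.Quotient.mk J (α • g) = α • Ideal.Quotient.mk J g := rfl
    rw [map_add, add_mul, this, smul_mul_assoc]
  rw [Set.mem_ofPred_eq, hadd, hμ, hμ]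
  exact hα

end Semicontinuity

/-! ### Nonnegativity of the normalizing factor. -/

section NormalizingFactor

/-- The alternating sum of truncated powers whose values are the normalizing factors. -/
def truncatedPowerSum (d : ℕ) (s : ℝ) : ℝ :=
  ∑ i ∈ Finset.range (d + 1), (-1 : ℝ) ^ i * (d.choose i : ℝ) * (max (s - i) 0) ^ d

theorem hasDerivAt_max_zero_pow (d : ℕ) (s : ℝ) :
    HasDerivAt (fun t : ℝ => (max t 0) ^ (d + 2)) ((d + 2) * (max s 0) ^ (d + 1)) s := by
  rcases lt_trichotomy s 0 with h | h | h
  · rw [max_eq_right h.le, zero_pow (by omega), mul_zero]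
    refine (hasDerivAt_const s (0 : ℝ)).congr_of_eventuallyEq ?_
    filter_upwards [Iio_mem_nhds h] with t ht
    rw [max_eq_right (le_of_lt ht), zero_pow (by omega)]
  · subst h
    rw [max_self, zero_pow (by omega), mul_zero, hasDerivAt_iff_isLittleO_nhds_zero]
    simp only [zero_add, max_self, smul_zero, sub_zero]
    rw [zero_pow (by omega)]
    simp only [sub_zero]
    refine Asymptotics.IsBigO.trans_isLittleO (g := fun h : ℝ => h ^ (d + 2)) ?_
      (Asymptotics.isLittleO_pow_id (by omega))
    refine Asymptotics.IsBigO.of_bound 1 (Eventually.of_forall fun h => ?_)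
    rw [one_mul, norm_pow, norm_pow]
    refine pow_le_pow_left₀ (norm_nonneg _) ?_ _
    rw [Real.norm_eq_abs, Real.norm_eq_abs, abs_of_nonneg (le_max_right _ _)]
    exact max_le (le_abs_self h) (abs_nonneg h)
  · rw [max_eq_left h.le]
    have := (hasDerivAt_pow (d + 2) s)
    push_cast at this
    refine this.congr_of_eventuallyEq ?_
    filter_upwards [Ioi_mem_nhds h] with t ht
    rw [max_eq_left (le_of_lt ht)]

theorem truncatedPowerSum_hasDerivAt (d : ℕ) (s : ℝ) :
    HasDerivAt (truncatedPowerSum (d + 2))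
      ((d + 2) * (truncatedPowerSum (d + 1) s - truncatedPowerSum (d + 1) (s - 1))) s := by
  have h : HasDerivAt (truncatedPowerSum (d + 2)) (∑ i ∈ Finset.range (d + 2 + 1),
      (-1 : ℝ) ^ i * ((d + 2).choose i : ℝ) * ((d + 2) * (max (s - i) 0) ^ (d + 1))) s := by
    unfold truncatedPowerSum
    refine HasDerivAt.fun_sum fun i _ => HasDerivAt.const_mul _ ?_
    exact (hasDerivAt_max_zero_pow d (s - i)).comp_sub_const s (i : ℝ)
  convert h using 1
  have h1 : truncatedPowerSum (d + 1) s = ∑ i ∈ Finset.range (d + 2 + 1),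
      (-1 : ℝ) ^ i * ((d + 1).choose i : ℝ) * (max (s - i) 0) ^ (d + 1) := by
    rw [Finset.sum_range_succ, Nat.choose_succ_self, truncatedPowerSum]
    simp
  -- Splitting off i = 0 aligns the sum at s - 1 with index i + 1, where Pascal's rule applies.
  rw [h1, truncatedPowerSum, Finset.sum_range_succ', Finset.sum_range_succ' _ (d + 2),
    add_sub_right_comm, ← Finset.sum_sub_distrib, mul_add, Finset.mul_sum]
  congr 1
  · refine Finset.sum_congr rfl fun i _ => ?_
    rw [Nat.choose_succ_succ' (d + 1) i, Nat.cast_succ, ← sub_sub, sub_right_comm s (i : ℝ) 1,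
      pow_succ (-1 : ℝ) i]
    push_cast
    ring
  · simp

/-- The derivative is a positive multiple of a difference of the previous function at s and s - 1,
so monotonicity propagates by induction. -/
theorem truncatedPowerSum_monotone (d : ℕ) : Monotone (truncatedPowerSum (d + 1)) := by
  induction d with
  | zero =>
    intro s t hst
    have h : ∀ x, truncatedPowerSum (0 + 1) x = max x 0 - max (x - 1) 0 := fun x => by
      simp [truncatedPowerSum, Finset.sum_range_succ, sub_eq_add_neg]
    rw [h, h]
    rcases max_cases s 0 with ⟨h1, _⟩ | ⟨h1, _⟩ <;> rcases max_cases (s - 1) 0 with ⟨h2, _⟩ | ⟨h2, _⟩ <;>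
      rcases max_cases t 0 with ⟨h3, _⟩ | ⟨h3, _⟩ <;>
      rcases max_cases (t - 1) 0 with ⟨h4, _⟩ | ⟨h4, _⟩ <;> linarith
  | succ d ih =>
    refine monotone_of_deriv_nonneg
      (fun s => (truncatedPowerSum_hasDerivAt d s).differentiableAt) fun s => ?_
    rw [(truncatedPowerSum_hasDerivAt d s).deriv]
    exact mul_nonneg (by positivity) (sub_nonneg.2 (ih (by linarith)))

theorem normalizingFactor_nonneg {s : ℝ} (hs : 0 < s) (d : ℕ) : 0 ≤ normalizingFactor s d := by
  rcases Nat.eq_zero_or_pos d with rfl | hd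
  · have : normalizingFactor s 0 = 1 := by
      rw [normalizingFactor, Finset.sum_eq_single 0]
      · simp
      · intro i _ hi
        simp [Nat.choose_eq_zero_of_lt (Nat.pos_of_ne_zero hi)]
      · simp
    rw [this]
    exact zero_le_one
  obtain ⟨c, rfl⟩ : ∃ c, d = c + 1 := ⟨d - 1, by omega⟩
  have hzero : truncatedPowerSum (c + 1) 0 = 0 := by
    refine Finset.sum_eq_zero fun i _ => ?_
    rw [max_eq_right (by simp), zero_pow (by omega), mul_zero]
  have hnonneg : 0 ≤ truncatedPowerSum (c + 1) s := hzero ▸ truncatedPowerSum_monotone c hs.le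
  have heq : normalizingFactor s (c + 1) =
      truncatedPowerSum (c + 1) s / ((c + 1).factorial : ℝ) := by
    rw [normalizingFactor, truncatedPowerSum, Finset.sum_div]
    have key : ∀ i : ℕ, i ∉ Finset.range (⌊s⌋₊ + 1) → max (s - i) 0 = 0 := fun i hi => by
      rw [Finset.mem_range, not_lt, Nat.succ_le_iff, Nat.floor_lt hs.le] at hi
      exact max_eq_right (by linarith)
    have key2 : ∀ i : ℕ, i ∈ Finset.range (⌊s⌋₊ + 1) → max (s - i) 0 = s - i := fun i hi => by
      rw [Finset.mem_range, Nat.lt_succ_iff, Nat.le_floor_iff hs.le] at hi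
      exact max_eq_left (by linarith)
    -- The two sums have different ranges. Outside the intersection either the binomial coefficient
    -- or the truncated power vanishes.
    trans ∑ i ∈ Finset.range (⌊s⌋₊ + 1) ∩ Finset.range (c + 1 + 1),
      (-1 : ℝ) ^ i * ((c + 1).choose i : ℝ) * (max (s - i) 0) ^ (c + 1) / ((c + 1).factorial : ℝ)
    · rw [← Finset.sum_subset (Finset.inter_subset_left (s₂ := Finset.range (c + 1 + 1)))]
      · refine Finset.sum_congr rfl fun i hi => ?_
        rw [key2 i (Finset.mem_inter.1 hi).1]
        ring
      · intro i hi hni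
        have : c + 1 < i := by
          by_contra h
          exact hni (Finset.mem_inter.2 ⟨hi, Finset.mem_range.2 (by omega)⟩)
        simp [Nat.choose_eq_zero_of_lt this]
    · refine Finset.sum_subset Finset.inter_subset_right fun i hi hni => ?_
      rw [key i (fun h => hni (Finset.mem_inter.2 ⟨h, hi⟩)), zero_pow (by omega), mul_zero,
        zero_div]
  rw [heq]
  positivity

end NormalizingFactor

/-! ### Assembly of the theorem. -/

theorem sMultiplicityExists_hypersurface {k : Type*} [Field k] {n : ℕ} (p : ℕ)
    [Fact p.Prime] [CharP k p] [PerfectRing k p] {f : MvPowerSeries (Fin (n + 1)) k}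
    (hf : f ∈ IsLocalRing.maximalIdeal (MvPowerSeries (Fin (n + 1)) k)) (hf0 : f ≠ 0)
    [IsLocalRing (MvPowerSeries (Fin (n + 1)) k ⧸ Ideal.span {f})] {s : ℝ} (hs : 0 < s) :
    SMultiplicityExists (MvPowerSeries (Fin (n + 1)) k ⧸ Ideal.span {f}) p s := by
  obtain ⟨l, hl⟩ := exists_tendsto_finrank_hypersurface p hf0 hs
  exact ⟨l, hl.congr fun e => (normalizedColength_hypersurface hf hf0 p s e).symm⟩

theorem sMultiplicity_hypersurface_le {k : Type*} [Field k] {n : ℕ} (p : ℕ)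
    [Fact p.Prime] [CharP k p] [PerfectRing k p] {f f' : MvPowerSeries (Fin (n + 1)) k}
    (hf : f ∈ IsLocalRing.maximalIdeal (MvPowerSeries (Fin (n + 1)) k)) (hf0 : f ≠ 0)
    (hf' : f' ∈ IsLocalRing.maximalIdeal (MvPowerSeries (Fin (n + 1)) k)) (hf0' : f' ≠ 0)
    [IsLocalRing (MvPowerSeries (Fin (n + 1)) k ⧸ Ideal.span {f})]
    [IsLocalRing (MvPowerSeries (Fin (n + 1)) k ⧸ Ideal.span {f'})] {s : ℝ} (hs : 0 < s)
    (h : ∀ a q : ℕ, Module.finrank k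
        (MvPowerSeries (Fin (n + 1)) k ⧸ (Ideal.span {f'} ⊔ mixedPower k n a q)) ≤
      Module.finrank k
        (MvPowerSeries (Fin (n + 1)) k ⧸ (Ideal.span {f} ⊔ mixedPower k n a q))) :
    sMultiplicity (MvPowerSeries (Fin (n + 1)) k ⧸ Ideal.span {f'}) p s ≤
      sMultiplicity (MvPowerSeries (Fin (n + 1)) k ⧸ Ideal.span {f}) p s := by
  obtain ⟨l, hl⟩ := sMultiplicityExists_hypersurface p hf hf0 hs
  obtain ⟨l', hl'⟩ := sMultiplicityExists_hypersurface p hf' hf0' hs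
  rw [sMultiplicity, sMultiplicity, sMultiplicityPair, sMultiplicityPair, hLimit, hLimit,
    hl.limUnder_eq, hl'.limUnder_eq, dimNat_hypersurface hf hf0, dimNat_hypersurface hf' hf0']
  refine div_le_div_of_nonneg_right ?_ (normalizingFactor_nonneg hs n)
  refine le_of_tendsto_of_tendsto' hl' hl fun e => ?_
  rw [normalizedColength_hypersurface hf hf0, normalizedColength_hypersurface hf' hf0']
  gcongr
  exact h _ _

/-- Infinite sets are dense in the cofinite topology. -/
theorem CofiniteTopology.dense_of_infinite {X : Type*} {Λ : Set (CofiniteTopology X)}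
    (h : Λ.Infinite) : Dense Λ := by
  rw [dense_iff_inter_open]
  intro U hU hne
  have hfin : Uᶜ.Finite := CofiniteTopology.isOpen_iff.1 hU hne
  by_contra hempty
  rw [Set.not_nonempty_iff_eq_empty] at hempty
  refine h (hfin.subset fun x hx hxU => ?_)
  exact (hempty ▸ (⟨hxU, hx⟩ : x ∈ U ∩ Λ) : x ∈ (∅ : Set _))

end

theorem mainTheorem8 {k : Type*} [Field k] [IsAlgClosed k] [Uncountable k]
    (p : ℕ) [CharP k p] (hp : 2 < p) (n : ℕ)
    (f g : MvPowerSeries (Fin (n + 1)) k)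
    (hf : f ∈ IsLocalRing.maximalIdeal (MvPowerSeries (Fin (n + 1)) k))
    (hg : g ∈ IsLocalRing.maximalIdeal (MvPowerSeries (Fin (n + 1)) k))
    (hf0 : f ≠ 0) (hgf : g ∉ Ideal.span {f}) :
    ∃ Λ : Set (CofiniteTopology k), Dense Λ ∧
      ∀ α : k, CofiniteTopology.of α ∈ Λ → ∀ s : ℝ, 0 < s →
        haveI := isLocalRing_quotient_span hf
        haveI := isLocalRing_quotient_span (add_smul_mem_maximalIdeal hf hg α)
        SMultiplicityExists (MvPowerSeries (Fin (n + 1)) k ⧸ Ideal.span {f}) p s ∧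
        SMultiplicityExists (MvPowerSeries (Fin (n + 1)) k ⧸ Ideal.span {f + α • g}) p s ∧
        sMultiplicity (MvPowerSeries (Fin (n + 1)) k ⧸ Ideal.span {f + α • g}) p s ≤
          sMultiplicity (MvPowerSeries (Fin (n + 1)) k ⧸ Ideal.span {f}) p s := by
  have hp0 : p ≠ 0 := by omega
  have : Fact p.Prime := ⟨(CharP.char_is_prime_or_zero k p).resolve_right hp0⟩
  let bad : ℕ × ℕ → Set k := fun x =>
    {α : k | Module.finrank k (MvPowerSeries (Fin (n + 1)) k ⧸
        (Ideal.span {f} ⊔ mixedPower k n x.1 x.2)) <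
      Module.finrank k (MvPowerSeries (Fin (n + 1)) k ⧸
        (Ideal.span {f + α • g} ⊔ mixedPower k n x.1 x.2))}
  have hcount : (⋃ x, bad x).Countable := Set.countable_iUnion fun x =>
    (finite_setOf_finrank_quotient_lt f g (mixedPower k n x.1 x.2)).countable
  have hinf : (⋃ x, bad x)ᶜ.Infinite := fun hfin =>
    Set.not_countable_univ (α := k) (by
      rw [← Set.union_compl_self (⋃ x, bad x)]
      exact hcount.union hfin.countable)
  refine ⟨CofiniteTopology.of '' (⋃ x, bad x)ᶜ, CofiniteTopology.dense_of_infinite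
    (hinf.image CofiniteTopology.of.injective.injOn), ?_⟩
  intro α hα s hs
  rw [CofiniteTopology.of.injective.mem_set_image, Set.mem_compl_iff, Set.mem_iUnion,
    not_exists] at hα
  -- If f + αg = 0, then either α = 0 and f = 0, or g is a scalar multiple of f.
  have hne : f + α • g ≠ 0 := by
    intro h0
    rcases eq_or_ne α 0 with rfl | hα0
    · exact hf0 (by simpa using h0)
    · refine hgf ?_
      have : g = -(α⁻¹ • f) := by
        rw [eq_neg_of_add_eq_zero_left h0, smul_neg, neg_neg, inv_smul_smul₀ hα0]
      rw [this]
      exact Submodule.neg_mem _ (Submodule.smul_of_tower_mem _ _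
        (Ideal.mem_span_singleton_self f))
  have := isLocalRing_quotient_span hf
  have hf' := add_smul_mem_maximalIdeal hf hg α
  have := isLocalRing_quotient_span hf'
  exact ⟨sMultiplicityExists_hypersurface p hf hf0 hs,
    sMultiplicityExists_hypersurface p hf' hne hs,
    sMultiplicity_hypersurface_le p hf hf0 hf' hne hs
      fun a q => not_lt.1 (hα (a, q))⟩
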